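/- Let $a,b,c,d\in\mathbb Z$ with $a$ odd and square-free, $b,c>0$, $d=b^2+c^2$ square-free and $\gcd(a,d)=1$, and let $L=\mathbb{Q}(z)$, where $z=\sqrt{a(d+b\sqrt d)}$, be the corresponding cyclic quartic field; put $w=\sqrt{a(d-b\sqrt d)}\in L$, with signs chosen so that $zw=ac\sqrt d$. A Hopf–Galois structure on $L/\mathbb Q$ is a finite-dimensional cocommutative $\mathbb Q$-Hopf algebra $H$ with a $\mathbb Q$-linear action on $L$ that makes $L$ a left $H$-module algebra and for which the map $L\otimes_{\mathbb Q}H\to\mathrm{End}_{\mathbb Q}(L)$, $x\otimes h\mapsto(y\mapsto x(h\cdot y))$, is bijective. It is classical if it is isomorphic, compatibly with the actions, to the group algebra $\mathbb Q[\mathrm{Gal}(L/\mathbb Q)]$ with its usual action on $L$. Let $H$ be a non-classical Hopf–Galois structure on $L/\mathbb Q$ (up to isomorphism there is exactly one, and it is of type $C_2\times C_2$), and let $\mathfrak A_H=\{h\in H : h\cdot\mathcal O_L\subseteq\mathcal O_L\}$ be the associated order. At least one of $b,c$ is odd. Put $(p,q)=(b,c)$ if $b$ is odd and $(p,q)=(c,b)$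 if $b$ is even. Then $\mathcal O_L$ is free as an $\mathfrak A_H$-module if and only if there are $x,y\in\mathbb Z$ such that $$x^2-dy^2=p\quad\text{and}\quad p\mid x-qy .$$ Moreover, let $x,y\in\mathbb Z$ be any such pair, and put $u=\frac{x-qy}{p}\in\mathbb Z$. Then the following element $\beta$ is a free generator of $\mathcal O_L$ as an $\mathfrak A_H$-module, where $n\bmod 2\in\{0,1\}$: 1. if $d$ is even: $\beta=1+\sqrt d+u\,z+y\,w$; 2. if $d$ and $b$ are odd: $\beta=\frac{1+\sqrt d}2+u\,z+y\,w$; 3. if $d$ is odd, $b$ is even and $a+b\equiv3\pmod 4$: $\beta=\frac{1+\sqrt d}2+u\,\frac{z+w}2+y\,\frac{z-w}2$; 4. if $d$ is odd, $b$ is even, $a+b\equiv1\pmod 4$ and $a\equiv c\pmod 4$: $$\beta=-\frac{y+(y\bmod 2)}2+\frac{y-u+1}2\cdot\frac{1+\sqrt d}2+u\,\frac{1+\sqrt d+z+w}4+y\,\frac{1-\sqrt d+z-w}4;$$ 5. if $d$ is odd, $b$ is even, $a+b\equiv1\pmod 4$ and $a\equiv-c\pmod 4$: $$\beta=-\frac{u-(u\bmod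 2)}2-\frac{y-u+1}2\cdot\frac{1+\sqrt d}2+y\,\frac{1+\sqrt d+z-w}4+u\,\frac{1-\sqrt d+z+w}4.$$ -/

import Mathlib

open scoped NumberField TensorProduct

noncomputable section

namespace HopfGalois

section Structures

variable (K L H : Type*) [Field K] [Field L] [Algebra K L] [Ring H] [HopfAlgebra K H]
  [Module H L] [IsScalarTower K H L]

/-- The canonical map `j : L ⊗ H → End_K(L)`, `j (x ⊗ h) (y) = x (h • y)`. -/
def canonicalMap : L ⊗[K] H →ₗ[K] Module.End K L :=
  TensorProduct.lift ((LinearMap.mul K (Module.End K L)).compl₁₂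
    (Algebra.lmul K L).toLinearMap (Algebra.lsmul K K L : H →ₐ[K] Module.End K L).toLinearMap)

variable {K L H} in
theorem canonicalMap_tmul_apply (x : L) (h : H) (y : L) :
    canonicalMap K L H (x ⊗ₜ[K] h) y = x * h • y := by
  simp [canonicalMap]

/-- For `x, y ∈ L`, the `K`-linear map `H ⊗ H → L` with `g ⊗ h ↦ (g • x) (h • y)`. -/
def tensorAct (x y : L) : H ⊗[K] H →ₗ[K] L :=
  LinearMap.mul' K L ∘ₗ TensorProduct.map
    ((LinearMap.toSpanSingleton H L x).restrictScalars K)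
    ((LinearMap.toSpanSingleton H L y).restrictScalars K)

variable {K L H} in
theorem tensorAct_tmul (x y : L) (g h : H) :
    tensorAct K L H x y (g ⊗ₜ[K] h) = (g • x) * (h • y) := by
  simp [tensorAct]

/-- A Hopf-Galois structure on `L/K`: a finite-dimensional cocommutative `K`-Hopf algebra `H`
with a `K`-linear action on `L` that makes `L` a left `H`-module algebra and for which the
canonical map `L ⊗ H → End_K(L)` is bijective. -/
structure IsHopfGalois : Prop where
  finite : Module.Finite K H
  cocomm : Coalgebra.IsCocomm K H
  smul_mul : ∀ (h : H) (x y : L),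
    h • (x * y) = tensorAct K L H x y (Coalgebra.comul (R := K) h)
  smul_one : ∀ h : H, h • (1 : L) = algebraMap K L (Coalgebra.counit (R := K) h)
  bijective : Function.Bijective (canonicalMap K L H)

/-- `(H, •)` is isomorphic to the classical Galois structure: the group algebra `K[G]`,
`G = Gal(L/K)`, with its usual action `(∑ k_g g) • x = ∑ k_g g(x)`. -/
def IsClassical : Prop :=
  ∃ e : H ≃ₐc[K] MonoidAlgebra K (L ≃ₐ[K] L), ∀ (h : H) (x : L),
    h • x = MonoidAlgebra.lift K (Module.End K L) (L ≃ₐ[K] L)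
      (DistribMulAction.toModuleEnd K L) (e h) x

end Structures

section AssociatedOrder

variable (H L : Type*) [Field L] [Ring H] [Module H L]

/-- The associated order `{h ∈ H | h • 𝓞 L ⊆ 𝓞 L}`. -/
def associatedOrder : Subring H where
  carrier := {h | ∀ x : L, IsIntegral ℤ x → IsIntegral ℤ (h • x)}
  mul_mem' := fun {g h} hg hh x hx => by rw [mul_smul]; exact hg _ (hh x hx)
  one_mem' := fun x hx => by rwa [one_smul]
  add_mem' := fun {g h} hg hh x hx => by rw [add_smul]; exact (hg x hx).add (hh x hx)
  zero_mem' := fun x _ => by rw [zero_smul]; exact isIntegral_zero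
  neg_mem' := fun {h} hh x hx => by rw [neg_smul]; exact (hh x hx).neg

instance associatedOrderModule : Module (associatedOrder H L) (𝓞 L) where
  smul h x := ⟨(h : H) • (x : L), h.2 _ x.2⟩
  one_smul x := Subtype.ext (one_smul H (x : L))
  mul_smul g h x := Subtype.ext (mul_smul (g : H) (h : H) (x : L))
  smul_zero h := Subtype.ext (smul_zero (h : H))
  smul_add h x y := Subtype.ext (smul_add (h : H) (x : L) (y : L))
  add_smul g h x := Subtype.ext (add_smul (g : H) (h : H) (x : L))
  zero_smul x := Subtype.ext (zero_smul H (x : L))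

variable {L} in
/-- `β` lies in `𝓞 L` and is a free generator of `𝓞 L` over the associated order. -/
def IsFreeGenerator (β : L) : Prop :=
  ∃ β' : 𝓞 L, (β' : L) = β ∧
    Function.Bijective fun h : associatedOrder H L => h • β'

end AssociatedOrder

end HopfGalois

end

/-!
The proof follows the structure `H` down to an explicit algebra of endomorphisms of `L`, and then
compares two lattices in coordinates.

*The action.* For a Hopf–Galois structure on a Galois extension `L/K` write `h = ∑ a_σ(h) σ` in the
`L`-basis of `End_K(L)` given by the automorphisms (`autBasis`, `autCoeff`). The module algebra law
says that the coefficient functions `a_σ : H → L` are orthogonal idempotents for convolution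
(`conv_autCoeff`), and bijectivity of the canonical map says that they form an `L`-basis of
`Hom_K(H, L)`. Hence the Galois group permutes them (`exists_perm_autCoeff`), compatibly with the
product of `H` (`perm_autCoeff_compat`). For a cyclic group of order four with generator `s` only
two permutations are possible for `s` (`perm_fin_four_eq`). If it is trivial, all `a_σ` have values
in `K` and `H` is the group algebra (`isClassical_of_fixed`). Otherwise `s` exchanges `a_s` and
`a_{s³}` and fixes the other two, so that `H` acts through the commutative algebra spanned by `1`,
`s²`, `s + s³` and `r (s - s³)`, where `r = √d` (`IsCyclicQuartic.exists_actsBy`). It preserves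
`ℚ(√d)`, where it acts as `ℚ[τ]` with the conjugation `τ`, and the span of `z` and `w`, where it
acts as `ℚ[ρ]` with `ρ² = d`.

*The ring of integers.* If `x = A + B` with `A ∈ ℚ(√d)` and `B` in the span of `z` and `w` is
integral, then so are `2 A`, `A² - B²` and `4 B²`; as `a d` is squarefree, the coordinates of `x`
are quarter integers (`IsCyclicQuartic.exists_of_isIntegral`), and congruences modulo powers of 2
give an integral basis in each case.

*Freeness.* In a suitable basis, both `𝓞 L` and the associated order are the lattice of integral
vectors `(i, j, m, n)` with `i ≡ m`, `j ≡ n` modulo `k`, where `k` is 1 or 2 (`IsLatticeModel`).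
A generator has to be a generator in each of the two blocks, and in the second block this means that
the determinant `p m² + 2 q m n - p n²` of `(m, n)` and `ρ (m, n)` is a unit
(`IsLatticeModel.exists_form_eq_one`, `IsLatticeModel.isFreeGenerator`). Its sign can be changed by
`(m, n) ↦ (n, -m)`, and `p` times this form is the norm `x² - d y²` with `x = p m + q n`, `y = n`.
-/

namespace HopfGalois

/-! ### Convolution of linear maps out of a coalgebra -/

section Convolution

variable {K L H : Type*} [Field K] [Field L] [Algebra K L] [Ring H] [HopfAlgebra K H]

/-- The convolution product of two `K`-linear maps `H → L`. -/
noncomputable def conv (f g : H →ₗ[K] L) : H →ₗ[K] L :=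
  LinearMap.mul' K L ∘ₗ TensorProduct.map f g ∘ₗ Coalgebra.comul

theorem conv_sum_sum {ι : Type*} (s : Finset ι) (c c' : ι → L) (f : ι → H →ₗ[K] L) :
    conv (∑ i ∈ s, c i • f i) (∑ j ∈ s, c' j • f j)
      = ∑ i ∈ s, ∑ j ∈ s, (c i * c' j) • conv (f i) (f j) := by
  ext h
  simp only [conv, LinearMap.comp_apply, LinearMap.sum_apply, LinearMap.smul_apply]
  generalize (Coalgebra.comul h : H ⊗[K] H) = t
  induction t with
  | zero => simp
  | add x y hx hy => simp only [map_add, hx, hy, smul_add, Finset.sum_add_distrib]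
  | tmul x y =>
    simp only [TensorProduct.map_tmul, LinearMap.mul'_apply, LinearMap.sum_apply,
      LinearMap.smul_apply, smul_eq_mul, Finset.sum_mul_sum]
    exact Finset.sum_congr rfl fun i _ => Finset.sum_congr rfl fun j _ => by ring

theorem comp_conv (t : L ≃ₐ[K] L) (f g : H →ₗ[K] L) :
    t.toLinearMap ∘ₗ conv f g = conv (t.toLinearMap ∘ₗ f) (t.toLinearMap ∘ₗ g) := by
  ext h
  simp only [conv, LinearMap.comp_apply]
  generalize (Coalgebra.comul h : H ⊗[K] H) = u
  induction u with
  | zero => simp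
  | add x y hx hy => simp only [map_add, hx, hy]
  | tmul x y => simp

end Convolution

/-! ### Coordinates of a Hopf–Galois structure with respect to the Galois group -/

section Coordinates

variable (K L : Type*) [Field K] [Field L] [Algebra K L] [FiniteDimensional K L] [IsGalois K L]

/-- The automorphisms of `L/K`, as a basis of the left `L`-vector space `End_K(L)`. -/
noncomputable def autBasis : Module.Basis (L ≃ₐ[K] L) L (L →ₗ[K] L) :=
  basisOfLinearIndependentOfCardEqFinrank
    (b := fun σ : L ≃ₐ[K] L => ((σ : L →ₐ[K] L).toLinearMap))
    ((linearIndependent_toLinearMap K L L).comp (fun σ : L ≃ₐ[K] L => (σ : L →ₐ[K] L))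
      (fun σ τ h => AlgEquiv.ext fun x => DFunLike.congr_fun h x))
    (by rw [Module.finrank_linearMap_self K L L, ← IsGalois.card_aut_eq_finrank K L,
      Nat.card_eq_fintype_card])

variable {K L}

theorem autBasis_apply (σ : L ≃ₐ[K] L) (x : L) : autBasis K L σ x = σ x := by
  simp [autBasis]

/-- Dedekind's independence of automorphisms, as a cancellation rule. -/
theorem eq_of_sum_aut_eq {c c' : (L ≃ₐ[K] L) → L}
    (h : ∀ x : L, ∑ σ : L ≃ₐ[K] L, c σ * σ x = ∑ σ : L ≃ₐ[K] L, c' σ * σ x) : c = c' := by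
  have h1 : ∑ σ, c σ • autBasis K L σ = ∑ σ, c' σ • autBasis K L σ := by
    ext x
    simpa [LinearMap.sum_apply, autBasis_apply] using h x
  have h2 := congrArg (autBasis K L).repr h1
  ext σ
  have h3 := DFunLike.congr_fun h2 σ
  rwa [(autBasis K L).repr_sum_self, (autBasis K L).repr_sum_self] at h3

variable {H : Type*} [Ring H] [HopfAlgebra K H] [Module H L] [IsScalarTower K H L]

variable (H) in
/-- The coefficient `a_σ(h)` in the expansion `h = ∑ a_σ(h) σ` of the action of `h` in terms of
the automorphisms of `L/K`. -/
noncomputable def autCoeff (σ : L ≃ₐ[K] L) : H →ₗ[K] L :=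
  (((autBasis K L).coord σ).restrictScalars K) ∘ₗ
    (Algebra.lsmul K K L : H →ₐ[K] Module.End K L).toLinearMap

theorem smul_eq_sum_autCoeff (h : H) (x : L) :
    h • x = ∑ σ : L ≃ₐ[K] L, autCoeff H σ h * σ x := by
  have := DFunLike.congr_fun
    ((autBasis K L).sum_repr (Algebra.lsmul K K L h : Module.End K L)) x
  rw [LinearMap.sum_apply] at this
  simp only [LinearMap.smul_apply, autBasis_apply, Algebra.lsmul_coe] at this
  exact this.symm

theorem autCoeff_eq_of_smul_eq {h : H} {c : (L ≃ₐ[K] L) → L}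
    (hc : ∀ x : L, h • x = ∑ σ : L ≃ₐ[K] L, c σ * σ x) (σ : L ≃ₐ[K] L) :
    autCoeff H σ h = c σ := by
  have := eq_of_sum_aut_eq (c := fun σ => autCoeff H σ h) (c' := c)
    (fun x => by rw [← smul_eq_sum_autCoeff, hc])
  exact congrFun this σ

theorem autCoeff_one [DecidableEq (L ≃ₐ[K] L)] (σ : L ≃ₐ[K] L) :
    autCoeff H σ (1 : H) = if σ = 1 then 1 else 0 :=
  autCoeff_eq_of_smul_eq (c := fun σ => if σ = 1 then 1 else 0) (by simp) σ

theorem autCoeff_mul (g h : H) (ρ : L ≃ₐ[K] L) :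
    autCoeff H ρ (g * h)
      = ∑ σ : L ≃ₐ[K] L, autCoeff H σ g * σ (autCoeff H (σ⁻¹ * ρ) h) := by
  refine autCoeff_eq_of_smul_eq
    (c := fun ρ => ∑ σ : L ≃ₐ[K] L, autCoeff H σ g * σ (autCoeff H (σ⁻¹ * ρ) h)) (fun x => ?_) ρ
  rw [mul_smul, smul_eq_sum_autCoeff (K := K) h x, smul_eq_sum_autCoeff (K := K) g]
  simp_rw [map_sum, map_mul, Finset.mul_sum, Finset.sum_mul]
  conv_rhs => rw [Finset.sum_comm]
  refine Finset.sum_congr rfl fun σ _ => ?_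
  refine Fintype.sum_equiv (Equiv.mulLeft σ) _ _ fun τ => ?_
  simp [mul_assoc]

theorem tensorAct_eq_sum (x y : L) (u : H ⊗[K] H) :
    tensorAct K L H x y u = ∑ σ : L ≃ₐ[K] L, ∑ τ : L ≃ₐ[K] L,
      LinearMap.mul' K L (TensorProduct.map (autCoeff H σ) (autCoeff H τ) u) * (σ x * τ y) := by
  induction u with
  | zero => simp
  | add u v hu hv => simp only [map_add, hu, hv, add_mul, Finset.sum_add_distrib]
  | tmul g h =>
    rw [tensorAct_tmul, smul_eq_sum_autCoeff (K := K) g, smul_eq_sum_autCoeff (K := K) h,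
      Finset.sum_mul_sum]
    refine Finset.sum_congr rfl fun i _ => Finset.sum_congr rfl fun j _ => ?_
    simp only [TensorProduct.map_tmul, LinearMap.mul'_apply]
    ring

/-- The coefficient functions are orthogonal idempotents for convolution: this is the module
algebra law `h (x y) = ∑ (h₁ x) (h₂ y)` read off on the independent functions `σ x * τ y`. -/
theorem conv_autCoeff [DecidableEq (L ≃ₐ[K] L)]
    (hmul : ∀ (h : H) (x y : L),
      h • (x * y) = tensorAct K L H x y (Coalgebra.comul (R := K) h)) (σ τ : L ≃ₐ[K] L) :
    conv (autCoeff H σ) (autCoeff H τ) = if σ = τ then autCoeff H σ else 0 := by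
  ext h
  have h1 : ∀ y : L, (fun σ : L ≃ₐ[K] L => ∑ τ : L ≃ₐ[K] L,
      conv (autCoeff H σ) (autCoeff H τ) h * τ y) = fun σ => autCoeff H σ h * σ y := by
    intro y
    refine eq_of_sum_aut_eq fun x => ?_
    have := hmul h x y
    rw [tensorAct_eq_sum, smul_eq_sum_autCoeff (K := K)] at this
    rw [eq_comm]
    convert this using 2 with σ _ σ _
    · rw [map_mul]; ring
    · rw [Finset.sum_mul]
      refine Finset.sum_congr rfl fun τ _ => ?_
      simp only [conv, LinearMap.comp_apply]
      ring
  have h2 : (fun τ => conv (autCoeff H σ) (autCoeff H τ) h)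
      = fun τ => if σ = τ then autCoeff H σ h else 0 := by
    refine eq_of_sum_aut_eq fun y => ?_
    simpa using congrFun (h1 y) σ
  have := congrFun h2 τ
  rw [this]
  split_ifs <;> rfl

/-! ### The Galois action on the coefficient functions -/

/-- The coefficient functions are independent over `L`: a relation between them is an `L`-linear
form on `End_K(L)` that vanishes on the image of `canonicalMap`, which is everything. -/
theorem eq_of_sum_autCoeff_eq (hsurj : Function.Surjective (canonicalMap K L H))
    {c c' : (L ≃ₐ[K] L) → L} (h : ∑ σ, c σ • autCoeff H σ = ∑ σ, c' σ • autCoeff H σ) :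
    c = c' := by
  have key : (autBasis K L).constr K c = (autBasis K L).constr K c' := by
    ext φ
    obtain ⟨t, rfl⟩ := hsurj φ
    induction t with
    | zero => simp
    | add x y hx hy => rw [map_add, map_add, map_add, hx, hy]
    | tmul x k =>
      have hk := DFunLike.congr_fun h k
      have hx : canonicalMap K L H (x ⊗ₜ[K] k)
          = x • (Algebra.lsmul K K L k : Module.End K L) := by
        ext y; simp [canonicalMap_tmul_apply]
      have e : ∀ c : (L ≃ₐ[K] L) → L,
          (autBasis K L).constr K c (Algebra.lsmul K K L k : Module.End K L)
            = (∑ σ, c σ • autCoeff H σ) k := by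
        intro c
        rw [Module.Basis.constr_apply_fintype, LinearMap.sum_apply]
        refine Finset.sum_congr rfl fun σ _ => ?_
        simp [autCoeff, mul_comm]
      rw [hx, map_smul, map_smul, e, e, h]
  ext σ
  have := DFunLike.congr_fun key (autBasis K L σ)
  rwa [Module.Basis.constr_basis, Module.Basis.constr_basis] at this

theorem finrank_eq_of_bijective (hbij : Function.Bijective (canonicalMap K L H))
    [Module.Finite K H] : Module.finrank K H = Module.finrank K L := by
  have h1 := (LinearEquiv.ofBijective _ hbij).finrank_eq
  rw [Module.finrank_tensorProduct, Module.finrank_linearMap] at h1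
  exact Nat.eq_of_mul_eq_mul_left Module.finrank_pos h1

/-- Every `K`-linear map `H → L` is an `L`-combination of the coefficient functions, which are
independent and of the right number. -/
theorem exists_eq_sum_autCoeff (hbij : Function.Bijective (canonicalMap K L H))
    [Module.Finite K H] (f : H →ₗ[K] L) :
    ∃ c : (L ≃ₐ[K] L) → L, f = ∑ σ, c σ • autCoeff H σ := by
  have hli : LinearIndependent L (fun σ : L ≃ₐ[K] L => autCoeff H σ) := by
    rw [Fintype.linearIndependent_iff]
    intro c hc σ
    have := eq_of_sum_autCoeff_eq hbij.2 (c := c) (c' := 0) (by simpa using hc)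
    exact congrFun this σ
  let B := basisOfLinearIndependentOfCardEqFinrank hli (by
    rw [Module.finrank_linearMap_self K L H, finrank_eq_of_bijective hbij,
      ← IsGalois.card_aut_eq_finrank K L, Nat.card_eq_fintype_card])
  refine ⟨B.repr f, ?_⟩
  conv_lhs => rw [← B.sum_repr f]
  simp [B]

open Classical in
theorem conv_sum_autCoeff (hHG : IsHopfGalois K L H) (c c' : (L ≃ₐ[K] L) → L) :
    conv (∑ σ, c σ • autCoeff H σ) (∑ σ, c' σ • autCoeff H σ)
      = ∑ σ, (c σ * c' σ) • autCoeff H σ := by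
  rw [conv_sum_sum]
  refine Finset.sum_congr rfl fun σ _ => ?_
  simp [conv_autCoeff hHG.smul_mul]

/-- Galois descent: applying `t ∈ Gal(L/K)` to the values of the coefficient functions permutes
them, because they are the primitive idempotents of the convolution algebra `Hom_K(H, L) ≅ L^G`. -/
theorem exists_perm_autCoeff (hHG : IsHopfGalois K L H) (t : L ≃ₐ[K] L) :
    ∃ p : Equiv.Perm (L ≃ₐ[K] L), ∀ σ h, t (autCoeff H σ h) = autCoeff H (p σ) h := by
  classical
  have := hHG.finite
  choose c hc using fun σ : L ≃ₐ[K] L =>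
    exists_eq_sum_autCoeff hHG.bijective (t.toLinearMap ∘ₗ autCoeff H σ)
  have horth : ∀ σ τ ρ, c σ ρ * c τ ρ = if σ = τ then c σ ρ else 0 := by
    intro σ τ ρ
    have h1 := comp_conv t (autCoeff H σ) (autCoeff H τ)
    rw [conv_autCoeff hHG.smul_mul, hc σ, hc τ, conv_sum_autCoeff hHG] at h1
    have h2 : ∑ ρ, (c σ ρ * c τ ρ) • autCoeff H ρ
        = ∑ ρ, (if σ = τ then c σ ρ else 0) • autCoeff H ρ := by
      rw [← h1]
      split_ifs with hστ
      · exact hc σ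
      · simp
    exact congrFun (eq_of_sum_autCoeff_eq hHG.bijective.2 h2) ρ
  have hne : ∀ σ, ∃ ρ, c σ ρ ≠ 0 := by
    intro σ
    by_contra! h0
    have h1 := hc σ
    simp only [h0, zero_smul, Finset.sum_const_zero] at h1
    have h2 : autCoeff H σ = 0 := by
      ext h
      have := DFunLike.congr_fun h1 h
      simpa using this
    have h3 : ∑ ρ, (Pi.single σ (1 : L) : (L ≃ₐ[K] L) → L) ρ • autCoeff H ρ
        = ∑ ρ, (0 : (L ≃ₐ[K] L) → L) ρ • autCoeff H ρ := by
      simp [Pi.single_apply, h2]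
    simpa using congrFun (eq_of_sum_autCoeff_eq hHG.bijective.2 h3) σ
  choose p hp using hne
  have hinj : Function.Injective p := by
    intro σ τ hστ
    by_contra hne
    have := horth σ τ (p σ)
    rw [if_neg hne] at this
    rcases mul_eq_zero.1 this with h | h
    · exact hp σ h
    · rw [hστ] at h; exact hp τ h
  have hsurj := Finite.surjective_of_injective hinj
  refine ⟨Equiv.ofBijective p ⟨hinj, hsurj⟩, fun σ h => ?_⟩
  have hval : ∀ ρ, c σ ρ = if ρ = p σ then 1 else 0 := by
    intro ρ
    split_ifs with hρ
    · have := horth σ σ ρ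
      rw [if_pos rfl, hρ] at this
      rw [hρ]
      exact mul_right_cancel₀ (hp σ) (by rw [this, one_mul])
    · obtain ⟨τ, rfl⟩ := hsurj ρ
      have hne : σ ≠ τ := fun e => hρ (by rw [e])
      have := horth σ τ (p τ)
      rw [if_neg hne] at this
      exact (mul_eq_zero.1 this).resolve_right (hp τ)
  have h1 := DFunLike.congr_fun (hc σ) h
  simp only [LinearMap.comp_apply, AlgEquiv.toLinearMap_apply, hval, ite_smul, one_smul,
    zero_smul, Finset.sum_ite_eq', Finset.mem_univ, if_true] at h1
  exact h1

/-- The functions `(g, k) ↦ a_σ(g) a_τ(k)` on `H × H` are independent over `L`. -/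
theorem eq_of_sum_autCoeff_mul_eq (hsurj : Function.Surjective (canonicalMap K L H))
    {p q : Equiv.Perm (L ≃ₐ[K] L)}
    {F G : (L ≃ₐ[K] L) → (L ≃ₐ[K] L)}
    (h : ∀ g k : H, ∑ σ, autCoeff H (p σ) g * autCoeff H (F σ) k
      = ∑ σ, autCoeff H (q σ) g * autCoeff H (G σ) k) (σ : L ≃ₐ[K] L) :
    F (p.symm σ) = G (q.symm σ) := by
  classical
  have key : ∀ k : H, (fun σ => autCoeff H (F (p.symm σ)) k)
      = fun σ => autCoeff H (G (q.symm σ)) k := by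
    intro k
    refine eq_of_sum_autCoeff_eq hsurj (H := H) ?_
    ext g
    simp only [LinearMap.sum_apply, LinearMap.smul_apply, smul_eq_mul]
    have h1 := h g k
    rw [← Equiv.sum_comp p, ← Equiv.sum_comp q (fun σ => autCoeff H (G (q.symm σ)) k * _)]
    simpa [mul_comm] using h1
  have h2 : ∑ ρ, (Pi.single (F (p.symm σ)) (1 : L) : (L ≃ₐ[K] L) → L) ρ • autCoeff H ρ
        = ∑ ρ, (Pi.single (G (q.symm σ)) (1 : L) : (L ≃ₐ[K] L) → L) ρ • autCoeff H ρ := by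
    ext k
    simpa [Pi.single_apply] using congrFun (key k) σ
  have h3 := congrFun (eq_of_sum_autCoeff_eq hsurj h2) (F (p.symm σ))
  by_contra hne
  rw [Pi.single_eq_same, Pi.single_eq_of_ne hne] at h3
  exact one_ne_zero h3

/-- The compatibility of the permutations `p` of the coefficient functions with the product of `H`,
from the two ways of computing `t (a_ρ(g k))`. -/
theorem perm_autCoeff_compat (hHG : IsHopfGalois K L H)
    {p : (L ≃ₐ[K] L) → Equiv.Perm (L ≃ₐ[K] L)}
    (hp : ∀ t σ (h : H), t (autCoeff H σ h) = autCoeff H (p t σ) h) (t σ ρ : L ≃ₐ[K] L) :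
    p t (p σ (σ⁻¹ * ρ)) = p (p t σ) ((p t σ)⁻¹ * p t ρ) := by
  have h1 : ∀ g k : H,
      ∑ σ, autCoeff H (p t σ) g * autCoeff H (p t (p σ (σ⁻¹ * ρ))) k
        = ∑ σ, autCoeff H ((Equiv.refl _) σ) g * autCoeff H (p σ (σ⁻¹ * p t ρ)) k := by
    intro g k
    have h2 := hp t ρ (g * k)
    rw [autCoeff_mul, autCoeff_mul, map_sum] at h2
    simp only [map_mul, hp] at h2
    exact h2
  have := eq_of_sum_autCoeff_mul_eq hHG.bijective.2 h1 (p t σ)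
  simpa using this

end Coordinates

/-! ### The group algebra -/

section Classical

variable {K L : Type*} [Field K] [Field L] [Algebra K L] [FiniteDimensional K L] [IsGalois K L]
  {H : Type*} [Ring H] [HopfAlgebra K H] [Module H L] [IsScalarTower K H L]

omit [FiniteDimensional K L] [IsGalois K L] in
theorem lsmul_injective (hinj : Function.Injective (canonicalMap K L H)) :
    Function.Injective (Algebra.lsmul K K L : H →ₐ[K] Module.End K L) := by
  intro g h hgh
  have h1 : canonicalMap K L H (1 ⊗ₜ[K] g) = canonicalMap K L H (1 ⊗ₜ[K] h) := by
    ext y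
    rw [canonicalMap_tmul_apply, canonicalMap_tmul_apply]
    exact congrArg (1 * ·) (DFunLike.congr_fun hgh y)
  exact Algebra.TensorProduct.includeRight_injective (R := K) (A := L) (B := H)
    (algebraMap K L).injective (hinj h1)

variable (K L) in
/-- The action of the group algebra on `L`, as a homomorphism into the endomorphisms. -/
noncomputable def groupAlgebraAction : MonoidAlgebra K (L ≃ₐ[K] L) →ₐ[K] Module.End K L :=
  MonoidAlgebra.lift K (Module.End K L) (L ≃ₐ[K] L) (DistribMulAction.toModuleEnd K L)

omit [IsGalois K L] in
theorem groupAlgebraAction_sum_single (k : (L ≃ₐ[K] L) → K) (x : L) :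
    groupAlgebraAction K L (∑ σ, MonoidAlgebra.single σ (k σ)) x
      = ∑ σ : L ≃ₐ[K] L, algebraMap K L (k σ) * σ x := by
  simp [groupAlgebraAction, map_sum, LinearMap.sum_apply, Algebra.smul_def]

omit [IsGalois K L] in
theorem eq_sum_single (u : MonoidAlgebra K (L ≃ₐ[K] L)) :
    u = ∑ σ, MonoidAlgebra.single σ (u.coeff σ) := by
  ext σ
  simp [MonoidAlgebra.coeff_sum]

theorem groupAlgebraAction_injective : Function.Injective (groupAlgebraAction K L) := by
  intro u v huv
  have h1 : (fun σ => algebraMap K L (u.coeff σ)) = fun σ => algebraMap K L (v.coeff σ) := by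
    refine eq_of_sum_aut_eq fun x => ?_
    rw [← groupAlgebraAction_sum_single, ← groupAlgebraAction_sum_single, ← eq_sum_single,
      ← eq_sum_single, huv]
  rw [eq_sum_single u, eq_sum_single v]
  refine Finset.sum_congr rfl fun σ _ => ?_
  rw [(algebraMap K L).injective (congrFun h1 σ)]

/-- If the Galois group fixes the values of all coefficient functions, these values lie in `K`,
and `h ↦ ∑ a_σ(h) σ` identifies `H` with the group algebra. -/
theorem isClassical_of_fixed (hHG : IsHopfGalois K L H)
    (hfix : ∀ (t σ : L ≃ₐ[K] L) (h : H), t (autCoeff H σ h) = autCoeff H σ h) :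
    IsClassical K L H := by
  classical
  have := hHG.finite
  have hex : ∀ (σ : L ≃ₐ[K] L) (h : H), ∃ k : K, algebraMap K L k = autCoeff H σ h := fun σ h =>
    (IsGalois.mem_range_algebraMap_iff_fixed _).2 fun t => hfix t σ h
  choose k0 hk0 using hex
  let k : (L ≃ₐ[K] L) → H →ₗ[K] K := fun σ =>
    { toFun := k0 σ
      map_add' := fun g h => (algebraMap K L).injective (by simp [hk0])
      map_smul' := fun c h => (algebraMap K L).injective (by
        rw [RingHom.id_apply, smul_eq_mul, map_mul, hk0, hk0, map_smul, Algebra.smul_def]) }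
  have hk : ∀ σ h, algebraMap K L (k σ h) = autCoeff H σ h := hk0
  let f : H → MonoidAlgebra K (L ≃ₐ[K] L) := fun h => ∑ σ, MonoidAlgebra.single σ (k σ h)
  have hf : ∀ h, groupAlgebraAction K L (f h) = Algebra.lsmul K K L h := by
    intro h
    ext x
    rw [groupAlgebraAction_sum_single]
    simp only [hk]
    exact (smul_eq_sum_autCoeff h x).symm
  have hinj := groupAlgebraAction_injective (K := K) (L := L)
  let F : H →ₐ[K] MonoidAlgebra K (L ≃ₐ[K] L) :=
    { toFun := f
      map_one' := hinj (by rw [hf]; simp)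
      map_mul' := fun g h => hinj (by rw [map_mul, hf, hf, hf, map_mul])
      map_zero' := hinj (by rw [hf]; simp)
      map_add' := fun g h => hinj (by rw [map_add, hf, hf, hf, map_add])
      commutes' := fun c => hinj (by rw [hf, AlgHom.commutes, AlgHom.commutes]) }
  have hF : ∀ h, F h = ∑ σ, MonoidAlgebra.single σ (k σ h) := fun h => rfl
  have hFinj : Function.Injective F := by
    intro g h hgh
    refine lsmul_injective hHG.bijective.1 ?_
    rw [← hf, ← hf]
    exact congrArg _ hgh
  have hFbij : Function.Bijective F := by
    refine ⟨hFinj, ?_⟩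
    have hr : Module.finrank K H = Module.finrank K (MonoidAlgebra K (L ≃ₐ[K] L)) := by
      rw [finrank_eq_of_bijective hHG.bijective, ← IsGalois.card_aut_eq_finrank K L,
        Nat.card_eq_fintype_card,
        (MonoidAlgebra.coeffLinearEquiv K).finrank_eq]
      simp
    exact (LinearMap.injective_iff_surjective_of_finrank_eq_finrank (f := F.toLinearMap) hr).1 hFinj
  have htens : ∀ u : H ⊗[K] H, TensorProduct.map F.toLinearMap F.toLinearMap u
      = ∑ σ, ∑ τ, LinearMap.mul' K K (TensorProduct.map (k σ) (k τ) u) •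
        (MonoidAlgebra.single σ (1 : K) ⊗ₜ[K] MonoidAlgebra.single τ (1 : K)) := by
    intro u
    induction u with
    | zero => simp
    | add x y hx hy => simp only [map_add, hx, hy, add_smul, Finset.sum_add_distrib]
    | tmul g h =>
      simp only [TensorProduct.map_tmul, AlgHom.toLinearMap_apply, hF, TensorProduct.sum_tmul,
        TensorProduct.tmul_sum, LinearMap.mul'_apply]
      rw [Finset.sum_comm]
      refine Finset.sum_congr rfl fun σ _ => Finset.sum_congr rfl fun τ _ => ?_
      rw [← TensorProduct.smul_tmul_smul]
      simp
  have hmulK : ∀ σ τ (u : H ⊗[K] H), algebraMap K L (LinearMap.mul' K K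
      (TensorProduct.map (k σ) (k τ) u))
        = LinearMap.mul' K L (TensorProduct.map (autCoeff H σ) (autCoeff H τ) u) := by
    intro σ τ u
    induction u with
    | zero => simp
    | add x y hx hy => simp only [map_add, hx, hy]
    | tmul g h => simp [hk]
  let E : H →ₐc[K] MonoidAlgebra K (L ≃ₐ[K] L) := BialgHom.ofAlgHom F
    (by
      ext h
      refine (algebraMap K L).injective ?_
      have h1 := hHG.smul_one h
      rw [smul_eq_sum_autCoeff (K := K)] at h1
      simp only [map_one, mul_one] at h1
      simp [hF, hk, h1])
    (by
      ext h
      change TensorProduct.map F.toLinearMap F.toLinearMap (Coalgebra.comul h)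
        = Coalgebra.comul (F h)
      rw [htens, hF, map_sum]
      refine Finset.sum_congr rfl fun σ _ => ?_
      have h1 : ∀ τ, LinearMap.mul' K K (TensorProduct.map (k σ) (k τ) (Coalgebra.comul h))
          = if σ = τ then k σ h else 0 := by
        intro τ
        refine (algebraMap K L).injective ?_
        rw [hmulK]
        have := DFunLike.congr_fun (conv_autCoeff hHG.smul_mul σ τ) h
        simp only [conv, LinearMap.comp_apply] at this
        rw [this]
        split_ifs <;> simp [hk]
      simp only [h1, ite_smul, zero_smul, Finset.sum_ite_eq, Finset.mem_univ, if_true]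
      have h2 : MonoidAlgebra.single σ (k σ h) = k σ h • MonoidAlgebra.single σ (1 : K) := by simp
      rw [h2, map_smul]
      simp)
  refine ⟨BialgEquiv.ofBijective E hFbij, fun h x => ?_⟩
  exact (DFunLike.congr_fun (hf h) x).symm

end Classical

/-! ### Hopf–Galois structures on a cyclic quartic extension -/

section Cyclic

/-- The permutations of `ℤ/4` that can describe the Galois action on the coefficient functions
of a Hopf–Galois structure on a cyclic quartic extension. -/
theorem perm_fin_four_eq (P : Equiv.Perm (Fin 4)) (h0 : P 0 = 0) (h4 : P ^ 4 = 1)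
    (hP : ∀ i : Fin 4, P ((P ^ (i : ℕ)) (-i)) = (P ^ (P i : ℕ)) (-P i)) :
    P = 1 ∨ (P 1 = 3 ∧ P 2 = 2 ∧ P 3 = 1) := by
  revert P
  decide

variable {K L : Type*} [Field K] [Field L] [Algebra K L] [FiniteDimensional K L] [IsGalois K L]
  {H : Type*} [Ring H] [HopfAlgebra K H] [Module H L] [IsScalarTower K H L]

theorem autCoeff_injective (hsurj : Function.Surjective (canonicalMap K L H)) :
    Function.Injective fun σ : L ≃ₐ[K] L => autCoeff (K := K) (L := L) H σ := by
  classical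
  intro σ τ hστ
  have h2 : ∑ ρ, (Pi.single σ (1 : L) : (L ≃ₐ[K] L) → L) ρ • autCoeff H ρ
        = ∑ ρ, (Pi.single τ (1 : L) : (L ≃ₐ[K] L) → L) ρ • autCoeff H ρ := by
    simpa [Pi.single_apply] using hστ
  have h3 := congrFun (eq_of_sum_autCoeff_eq hsurj h2) σ
  by_contra hne
  rw [Pi.single_eq_same, Pi.single_eq_of_ne hne] at h3
  exact one_ne_zero h3

/-- In a non-classical Hopf–Galois structure on a cyclic quartic extension with generator `s` of
the Galois group, `s` fixes the coefficients of `1` and `s²` and exchanges those of `s` and `s³`. -/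
theorem map_autCoeff_of_not_isClassical (hHG : IsHopfGalois K L H) (hnc : ¬ IsClassical K L H)
    (s : L ≃ₐ[K] L) (hs4 : s ^ 4 = 1)
    (hbij : Function.Bijective fun i : Fin 4 => s ^ (i : ℕ)) (h : H) :
    s (autCoeff H (1 : L ≃ₐ[K] L) h) = autCoeff H (1 : L ≃ₐ[K] L) h ∧
      s (autCoeff H s h) = autCoeff H (s ^ 3) h ∧
      s (autCoeff H (s ^ 2) h) = autCoeff H (s ^ 2) h ∧
      s (autCoeff H (s ^ 3) h) = autCoeff H s h := by
  classical
  choose p hp using fun t : L ≃ₐ[K] L => exists_perm_autCoeff (H := H) hHG t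
  have hinj := autCoeff_injective (K := K) (L := L) (H := H) hHG.bijective.2
  have hp1 : p 1 = 1 := by
    ext1 σ
    refine hinj (LinearMap.ext fun k => ?_)
    simp [← hp]
  have hpmul : ∀ t t', p (t * t') = p t * p t' := by
    intro t t'
    ext1 σ
    refine hinj (LinearMap.ext fun k => ?_)
    simp [← hp]
  have hppow : ∀ n : ℕ, p (s ^ n) = p s ^ n := by
    intro n
    induction n with
    | zero => simp [hp1]
    | succ n ih => rw [pow_succ, hpmul, ih, pow_succ]
  have hfix1 : ∀ t, p t 1 = 1 := by
    intro t
    have h1 := hp t 1 (1 : H)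
    rw [autCoeff_one (K := K), autCoeff_one (K := K), if_pos rfl, map_one] at h1
    by_contra hne
    rw [if_neg hne] at h1
    exact one_ne_zero h1
  let e : Fin 4 ≃ (L ≃ₐ[K] L) := Equiv.ofBijective _ hbij
  have he : ∀ i, e i = s ^ (i : ℕ) := fun i => rfl
  have hneg : ∀ i, e (-i) = (e i)⁻¹ := by
    intro i
    have hi : ∀ i : Fin 4, ((-i : Fin 4) : ℕ) + i = 0 ∨ ((-i : Fin 4) : ℕ) + i = 4 := by decide
    rw [eq_inv_iff_mul_eq_one, he, he, ← pow_add]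
    rcases hi i with hi | hi <;> rw [hi]
    exacts [pow_zero s, hs4]
  let P : Equiv.Perm (Fin 4) := e.symm.permCongr (p s)
  have hP : ∀ i, e (P i) = p s (e i) := by intro i; simp [P, Equiv.permCongr_apply]
  have hPpow : ∀ (n : ℕ) i, e ((P ^ n) i) = (p s ^ n) (e i) := by
    intro n
    induction n with
    | zero => simp
    | succ n ih =>
      intro i
      rw [pow_succ, pow_succ, Equiv.Perm.mul_apply, ih, hP, Equiv.Perm.mul_apply]
  have he0 : e 0 = 1 := by simp [he]
  have hcases := perm_fin_four_eq P (e.injective (by rw [hP, he0, hfix1]))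
    (Equiv.ext fun i => e.injective (by rw [hPpow, ← hppow, hs4, hp1]; simp))
    (fun i => e.injective (by
      rw [hP, hPpow, hPpow, hneg, hneg, ← hppow, ← hppow, ← he, ← he, hP]
      have := perm_autCoeff_compat hHG hp s (e i) 1
      rwa [hfix1, mul_one, mul_one] at this))
  rcases hcases with h1 | ⟨h1, h2, h3⟩
  · refine absurd (isClassical_of_fixed hHG fun t σ k => ?_) hnc
    have hps : p s = 1 := by
      ext1 σ
      obtain ⟨i, rfl⟩ := e.surjective σ
      rw [← hP, h1]; simp
    obtain ⟨i, rfl⟩ := e.surjective t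
    rw [hp, he, hppow, hps, one_pow, Equiv.Perm.one_apply]
  · have e1 : e 1 = s := by simp [he]
    have e2 : e 2 = s ^ 2 := rfl
    have e3 : e 3 = s ^ 3 := rfl
    refine ⟨by rw [hp, hfix1], ?_, ?_, ?_⟩
    · have := hP 1
      rw [h1, e1, e3] at this
      rw [hp, this]
    · have := hP 2
      rw [h2, e2] at this
      rw [hp, ← this]
    · have := hP 3
      rw [h3, e1, e3] at this
      rw [hp, ← this]

end Cyclic

/-! ### Cyclic quartic fields -/

/-- The data of the cyclic quartic field `L = ℚ(z)`: `r = √d`, `z = √(a (d + b√d))` and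
`w = √(a (d - b√d))`, with signs such that `z w = a c √d`. -/
structure IsCyclicQuartic {L : Type*} [Field L] [NumberField L] (a b c d : ℤ) (r z w : L) :
    Prop where
  odd_a : Odd a
  squarefree_a : Squarefree a
  b_pos : 0 < b
  c_pos : 0 < c
  d_eq : d = b ^ 2 + c ^ 2
  squarefree_d : Squarefree d
  coprime : IsCoprime a d
  r_sq : r ^ 2 = d
  z_sq : z ^ 2 = a * (d + b * r)
  w_sq : w ^ 2 = a * (d - b * r)
  z_mul_w : z * w = a * c * r
  adjoin_eq : IntermediateField.adjoin ℚ {z} = ⊤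

/-- The element `t₀ + t₁ r + t₂ z + t₃ w`. -/
def comb {L : Type*} [Field L] [CharZero L] (r z w : L) (t₀ t₁ t₂ t₃ : ℚ) : L :=
  t₀ + t₁ * r + t₂ * z + t₃ * w

namespace IsCyclicQuartic

variable {L : Type*} [Field L] [NumberField L] {a b c d : ℤ} {r z w : L}

theorem a_ne_zero (Q : IsCyclicQuartic a b c d r z w) : a ≠ 0 := Q.squarefree_a.ne_zero

theorem d_eq_cast (Q : IsCyclicQuartic a b c d r z w) {F : Type*} [Ring F] :
    (d : F) = (b : F) ^ 2 + (c : F) ^ 2 := by rw [Q.d_eq]; push_cast; rfl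

theorem one_lt_d (Q : IsCyclicQuartic a b c d r z w) : 1 < d := by
  have := Q.b_pos
  have := Q.c_pos
  rw [Q.d_eq]
  nlinarith

theorem isCoprime_b_c (Q : IsCyclicQuartic a b c d r z w) : IsCoprime b c := by
  rw [Int.isCoprime_iff_gcd_eq_one]
  have h1 : ((Int.gcd b c : ℤ)) * (Int.gcd b c : ℤ) ∣ d := by
    rw [Q.d_eq, sq, sq]
    exact dvd_add (mul_dvd_mul (Int.gcd_dvd_left ..) (Int.gcd_dvd_left ..))
      (mul_dvd_mul (Int.gcd_dvd_right ..) (Int.gcd_dvd_right ..))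
  have h2 := Q.squarefree_d _ h1
  rw [Int.isUnit_iff] at h2
  omega

theorem not_isSquare_d (Q : IsCyclicQuartic a b c d r z w) : ¬ IsSquare d := by
  rintro ⟨k, hk⟩
  have h1 := Q.squarefree_d k ⟨1, by rw [mul_one, hk]⟩
  have h2 := Q.one_lt_d
  rcases Int.isUnit_iff.1 h1 with rfl | rfl <;> simp [hk] at h2

theorem eq_zero_of_sq_eq (Q : IsCyclicQuartic a b c d r z w) {x y : ℚ}
    (h : x ^ 2 = d * y ^ 2) : x = 0 ∧ y = 0 := by
  have hy : y = 0 := by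
    by_contra hy
    refine Q.not_isSquare_d (Rat.isSquare_intCast_iff.1 ⟨x / y, ?_⟩)
    field_simp
    linarith
  subst hy
  exact ⟨by simpa using h, rfl⟩

theorem r_ne_zero (Q : IsCyclicQuartic a b c d r z w) : r ≠ 0 := by
  rintro rfl
  have h1 := Q.r_sq
  have h2 := Q.one_lt_d
  rw [zero_pow two_ne_zero] at h1
  have : d = 0 := by exact_mod_cast h1.symm
  omega

theorem z_mul_w_ne_zero (Q : IsCyclicQuartic a b c d r z w) : z * w ≠ 0 := by
  rw [Q.z_mul_w]
  exact mul_ne_zero (mul_ne_zero (Int.cast_ne_zero.2 Q.a_ne_zero)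
    (Int.cast_ne_zero.2 Q.c_pos.ne')) Q.r_ne_zero

theorem r_mul_z (Q : IsCyclicQuartic a b c d r z w) : r * z = b * z + c * w := by
  have hz : z ≠ 0 := left_ne_zero_of_mul Q.z_mul_w_ne_zero
  refine mul_left_cancel₀ hz ?_
  linear_combination (r - b) * Q.z_sq - c * Q.z_mul_w + a * b * Q.r_sq
    + a * r * Q.d_eq_cast (F := L)

theorem r_mul_w (Q : IsCyclicQuartic a b c d r z w) : r * w = c * z - b * w := by
  have hw : w ≠ 0 := right_ne_zero_of_mul Q.z_mul_w_ne_zero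
  refine mul_left_cancel₀ hw ?_
  linear_combination (r + b) * Q.w_sq - c * Q.z_mul_w - a * b * Q.r_sq
    + a * r * Q.d_eq_cast (F := L)

/-- The multiplication table of `L` in the basis `1, r, z, w`. -/
theorem comb_mul (Q : IsCyclicQuartic a b c d r z w) (t₀ t₁ t₂ t₃ u₀ u₁ u₂ u₃ : ℚ) :
    comb r z w t₀ t₁ t₂ t₃ * comb r z w u₀ u₁ u₂ u₃ = comb r z w
      (t₀ * u₀ + d * t₁ * u₁ + a * d * (t₂ * u₂ + t₃ * u₃))
      (t₀ * u₁ + t₁ * u₀ + a * b * (t₂ * u₂ - t₃ * u₃) + a * c * (t₂ * u₃ + t₃ * u₂))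
      (t₀ * u₂ + t₂ * u₀ + b * (t₁ * u₂ + t₂ * u₁) + c * (t₁ * u₃ + t₃ * u₁))
      (t₀ * u₃ + t₃ * u₀ + c * (t₁ * u₂ + t₂ * u₁) - b * (t₁ * u₃ + t₃ * u₁)) := by
  simp only [comb]
  push_cast
  linear_combination (t₁ : L) * u₁ * Q.r_sq + (t₂ : L) * u₂ * Q.z_sq + (t₃ : L) * u₃ * Q.w_sq
    + ((t₂ : L) * u₃ + t₃ * u₂) * Q.z_mul_w + ((t₁ : L) * u₂ + t₂ * u₁) * Q.r_mul_z
    + ((t₁ : L) * u₃ + t₃ * u₁) * Q.r_mul_w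

theorem eq_zero_of_add_mul_r (Q : IsCyclicQuartic a b c d r z w) {x y : ℚ}
    (h : (x : L) + y * r = 0) : x = 0 ∧ y = 0 := by
  refine Q.eq_zero_of_sq_eq ?_
  have : (x : L) ^ 2 = d * (y : L) ^ 2 := by
    linear_combination ((x : L) - y * r) * h + (y : L) ^ 2 * Q.r_sq
  exact_mod_cast this

/-- Independence of `1, r, z, w`. If `A = t₀ + t₁ r` and `B = t₂ z + t₃ w` satisfy `A + B = 0`,
then the norm of `A² = B²` from `ℚ(r)` is both a square and `d` times a square. -/
theorem eq_zero_of_comb_eq_zero (Q : IsCyclicQuartic a b c d r z w) {t₀ t₁ t₂ t₃ : ℚ}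
    (h : comb r z w t₀ t₁ t₂ t₃ = 0) : t₀ = 0 ∧ t₁ = 0 ∧ t₂ = 0 ∧ t₃ = 0 := by
  have h1 := Q.comb_mul t₀ t₁ t₂ t₃ t₀ t₁ (-t₂) (-t₃)
  rw [h, zero_mul] at h1
  have h2 := Q.eq_zero_of_add_mul_r (x := t₀ ^ 2 + d * t₁ ^ 2 - a * d * (t₂ ^ 2 + t₃ ^ 2))
    (y := 2 * t₀ * t₁ - a * b * (t₂ ^ 2 - t₃ ^ 2) - 2 * a * c * t₂ * t₃) (by
      rw [h1, comb]; push_cast; ring)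
  have hd := Q.d_eq_cast (F := ℚ)
  have h3 := Q.eq_zero_of_sq_eq (x := t₀ ^ 2 - d * t₁ ^ 2)
    (y := a * (c * (t₂ ^ 2 - t₃ ^ 2) - 2 * b * t₂ * t₃)) (by
      have e1 : t₀ ^ 2 + d * t₁ ^ 2 = a * d * (t₂ ^ 2 + t₃ ^ 2) := by linarith [h2.1]
      have e2 : 2 * t₀ * t₁ = a * b * (t₂ ^ 2 - t₃ ^ 2) + 2 * a * c * t₂ * t₃ := by
        linarith [h2.2]
      have e3 : (t₀ ^ 2 - d * t₁ ^ 2) ^ 2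
          = (t₀ ^ 2 + d * t₁ ^ 2) ^ 2 - d * (2 * t₀ * t₁) ^ 2 := by ring
      rw [e3, e1, e2]
      linear_combination (a : ℚ) ^ 2 * d * (t₂ ^ 2 + t₃ ^ 2) ^ 2 * hd)
  have h4 := Q.eq_zero_of_sq_eq (x := t₀) (y := t₁) (by linarith [h3.1])
  obtain ⟨rfl, rfl⟩ := h4
  have h5 : (a : ℚ) * d * (t₂ ^ 2 + t₃ ^ 2) = 0 := by linarith [h2.1]
  have ha : (a : ℚ) ≠ 0 := Int.cast_ne_zero.2 Q.a_ne_zero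
  have hd0 : (d : ℚ) ≠ 0 := Int.cast_ne_zero.2 Q.squarefree_d.ne_zero
  have h6 : t₂ ^ 2 + t₃ ^ 2 = 0 := by
    rcases mul_eq_zero.1 h5 with h | h
    · exact absurd h (mul_ne_zero ha hd0)
    · exact h
  refine ⟨rfl, rfl, ?_, ?_⟩ <;> nlinarith [sq_nonneg t₂, sq_nonneg t₃]

theorem comb_injective (Q : IsCyclicQuartic a b c d r z w) {t₀ t₁ t₂ t₃ u₀ u₁ u₂ u₃ : ℚ}
    (h : comb r z w t₀ t₁ t₂ t₃ = comb r z w u₀ u₁ u₂ u₃) :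
    t₀ = u₀ ∧ t₁ = u₁ ∧ t₂ = u₂ ∧ t₃ = u₃ := by
  have := Q.eq_zero_of_comb_eq_zero (t₀ := t₀ - u₀) (t₁ := t₁ - u₁) (t₂ := t₂ - u₂)
    (t₃ := t₃ - u₃) (by
      simp only [comb] at h ⊢
      push_cast
      linear_combination h)
  simpa [sub_eq_zero] using this

theorem exists_eq_comb (Q : IsCyclicQuartic a b c d r z w) (x : L) :
    ∃ t₀ t₁ t₂ t₃ : ℚ, x = comb r z w t₀ t₁ t₂ t₃ := by
  have hx : x ∈ Algebra.adjoin ℚ {z} := by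
    rw [← IntermediateField.adjoin_simple_toSubalgebra_of_isAlgebraic
      (Algebra.IsAlgebraic.isAlgebraic z), Q.adjoin_eq]
    trivial
  induction hx using Algebra.adjoin_induction with
  | mem x hx => exact ⟨0, 0, 1, 0, by rw [Set.mem_singleton_iff.1 hx]; simp [comb]⟩
  | algebraMap q => exact ⟨q, 0, 0, 0, by simp [comb]⟩
  | add x y _ _ hx hy =>
    obtain ⟨t₀, t₁, t₂, t₃, rfl⟩ := hx
    obtain ⟨u₀, u₁, u₂, u₃, rfl⟩ := hy
    exact ⟨t₀ + u₀, t₁ + u₁, t₂ + u₂, t₃ + u₃, by simp only [comb]; push_cast; ring⟩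
  | mul x y _ _ hx hy =>
    obtain ⟨t₀, t₁, t₂, t₃, rfl⟩ := hx
    obtain ⟨u₀, u₁, u₂, u₃, rfl⟩ := hy
    exact ⟨_, _, _, _, Q.comb_mul _ _ _ _ _ _ _ _⟩

theorem comb_eq_sum (t : Fin 4 → ℚ) :
    ∑ i, t i • (![1, r, z, w] : Fin 4 → L) i = comb r z w (t 0) (t 1) (t 2) (t 3) := by
  simp [Fin.sum_univ_four, comb, Algebra.smul_def]

/-- The basis `1, r, z, w` of `L/ℚ`. -/
noncomputable def basis (Q : IsCyclicQuartic a b c d r z w) : Module.Basis (Fin 4) ℚ L :=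
  Module.Basis.mk (v := ![1, r, z, w])
    (by
      rw [Fintype.linearIndependent_iff]
      intro t ht
      rw [comb_eq_sum] at ht
      obtain ⟨h0, h1, h2, h3⟩ := Q.eq_zero_of_comb_eq_zero ht
      intro i
      fin_cases i <;> assumption)
    (by
      rintro x -
      obtain ⟨t₀, t₁, t₂, t₃, rfl⟩ := Q.exists_eq_comb x
      rw [Submodule.mem_span_range_iff_exists_fun]
      exact ⟨![t₀, t₁, t₂, t₃], by rw [comb_eq_sum]; simp⟩)

theorem finrank_eq (Q : IsCyclicQuartic a b c d r z w) : Module.finrank ℚ L = 4 := by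
  rw [Module.finrank_eq_card_basis Q.basis, Fintype.card_fin]

/-- The linear map underlying the generator of the Galois group. -/
noncomputable def genLinear (Q : IsCyclicQuartic a b c d r z w) : L →ₗ[ℚ] L :=
  Q.basis.constr ℚ ![1, -r, w, -z]

theorem genLinear_comb (Q : IsCyclicQuartic a b c d r z w) (t₀ t₁ t₂ t₃ : ℚ) :
    Q.genLinear (comb r z w t₀ t₁ t₂ t₃) = comb r z w t₀ (-t₁) (-t₃) t₂ := by
  have h1 : comb r z w t₀ t₁ t₂ t₃ = ∑ i, ![t₀, t₁, t₂, t₃] i • Q.basis i := by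
    have := comb_eq_sum (r := r) (z := z) (w := w) ![t₀, t₁, t₂, t₃]
    simpa [basis] using this.symm
  rw [h1, map_sum]
  simp only [map_smul, genLinear, Module.Basis.constr_basis]
  simp [Fin.sum_univ_four, comb, Algebra.smul_def]
  ring

/-- The generator `s` of the Galois group with `s r = -r`, `s z = w`, `s w = -z`. -/
noncomputable def gen (Q : IsCyclicQuartic a b c d r z w) : L ≃ₐ[ℚ] L :=
  AlgEquiv.ofBijective
    (AlgHom.ofLinearMap Q.genLinear
      (by
        have := Q.genLinear_comb 1 0 0 0
        simpa [comb] using this)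
      (by
        intro x y
        obtain ⟨t₀, t₁, t₂, t₃, rfl⟩ := Q.exists_eq_comb x
        obtain ⟨u₀, u₁, u₂, u₃, rfl⟩ := Q.exists_eq_comb y
        rw [Q.comb_mul, Q.genLinear_comb, Q.genLinear_comb, Q.genLinear_comb, Q.comb_mul]
        congr 1 <;> ring))
    (AlgHom.bijective _)

theorem gen_comb (Q : IsCyclicQuartic a b c d r z w) (t₀ t₁ t₂ t₃ : ℚ) :
    Q.gen (comb r z w t₀ t₁ t₂ t₃) = comb r z w t₀ (-t₁) (-t₃) t₂ :=
  Q.genLinear_comb t₀ t₁ t₂ t₃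

theorem gen_r (Q : IsCyclicQuartic a b c d r z w) : Q.gen r = -r := by
  simpa [comb] using Q.gen_comb 0 1 0 0

theorem gen_z (Q : IsCyclicQuartic a b c d r z w) : Q.gen z = w := by
  simpa [comb] using Q.gen_comb 0 0 1 0

theorem gen_w (Q : IsCyclicQuartic a b c d r z w) : Q.gen w = -z := by
  simpa [comb] using Q.gen_comb 0 0 0 1

theorem gen_pow_four (Q : IsCyclicQuartic a b c d r z w) : Q.gen ^ 4 = 1 := by
  ext x
  obtain ⟨t₀, t₁, t₂, t₃, rfl⟩ := Q.exists_eq_comb x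
  simp [pow_succ, gen_comb]

theorem gen_pow_injective (Q : IsCyclicQuartic a b c d r z w) :
    Function.Injective fun i : Fin 4 => Q.gen ^ (i : ℕ) := by
  have key : ∀ i : Fin 4, (Q.gen ^ (i : ℕ)) z = (![z, w, -z, -w] : Fin 4 → L) i := by
    intro i
    fin_cases i <;> simp [pow_succ, gen_z, gen_w]
  have key' : ∀ i : Fin 4, (Q.gen ^ (i : ℕ)) z
      = comb r z w 0 0 ((![1, 0, -1, 0] : Fin 4 → ℚ) i) ((![0, 1, 0, -1] : Fin 4 → ℚ) i) := by
    intro i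
    rw [key]
    fin_cases i <;> simp [comb]
  intro i j hij
  have h1 := DFunLike.congr_fun hij z
  simp only [key'] at h1
  obtain ⟨-, -, h2, h3⟩ := Q.comb_injective h1
  revert h2 h3
  fin_cases i <;> fin_cases j <;> norm_num

theorem isGalois (Q : IsCyclicQuartic a b c d r z w) : IsGalois ℚ L := by
  refine IsGalois.of_card_aut_eq_finrank ℚ L (le_antisymm ?_ ?_)
  · rw [Nat.card_eq_fintype_card]
    exact AlgEquiv.card_le
  · rw [Q.finrank_eq, Nat.card_eq_fintype_card]
    simpa using Fintype.card_le_of_injective _ Q.gen_pow_injective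

theorem gen_pow_bijective (Q : IsCyclicQuartic a b c d r z w) :
    Function.Bijective fun i : Fin 4 => Q.gen ^ (i : ℕ) := by
  have := Q.isGalois
  rw [Fintype.bijective_iff_injective_and_card]
  refine ⟨Q.gen_pow_injective, ?_⟩
  rw [← Nat.card_eq_fintype_card (α := L ≃ₐ[ℚ] L), IsGalois.card_aut_eq_finrank, Q.finrank_eq,
    Fintype.card_fin]

end IsCyclicQuartic

/-! ### The non-classical structure on a cyclic quartic field -/

/-- `h` acts on `ℚ(√d) = ⟨1, r⟩` as `α + β τ`, where `τ` is the conjugation, and on `⟨z, w⟩` as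
`γ + δ ρ`, where `ρ = r (s - s³)/2`, so that `ρ² = d`, `ρ z = c z - b w` and
`ρ w = -b z - c w`. -/
def ActsBy {L H : Type*} [Field L] [CharZero L] [Ring H] [Module H L] (b c : ℤ) (r z w : L)
    (h : H) (α β γ δ : ℚ) : Prop :=
  ∀ t₀ t₁ t₂ t₃ : ℚ, h • comb r z w t₀ t₁ t₂ t₃ = comb r z w ((α + β) * t₀) ((α - β) * t₁)
    ((γ + δ * c) * t₂ - δ * b * t₃) (-(δ * b) * t₂ + (γ - δ * c) * t₃)

namespace IsCyclicQuartic

variable {L : Type*} [Field L] [NumberField L] {a b c d : ℤ} {r z w : L}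
  {H : Type*} [Ring H] [HopfAlgebra ℚ H] [Module H L] [IsScalarTower ℚ H L]

/-- The action of a non-classical structure in the basis `1, r, z, w`: here `h` is
`(α + γ)/2 + (α - γ)/2 s² + (β + δ r)/2 s + (β - δ r)/2 s³`. -/
theorem exists_actsBy (Q : IsCyclicQuartic a b c d r z w) (hHG : IsHopfGalois ℚ L H)
    (hnc : ¬ IsClassical ℚ L H) (h : H) : ∃ α β γ δ : ℚ, ActsBy b c r z w h α β γ δ := by
  have := Q.isGalois
  obtain ⟨h0, h1, h2, h3⟩ := map_autCoeff_of_not_isClassical hHG hnc Q.gen Q.gen_pow_four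
    Q.gen_pow_bijective h
  have hrat : ∀ x : L, Q.gen x = x → ∃ t : ℚ, x = t := by
    intro x hx
    obtain ⟨t₀, t₁, t₂, t₃, rfl⟩ := Q.exists_eq_comb x
    rw [gen_comb] at hx
    obtain ⟨-, e1, e2, e3⟩ := Q.comb_injective hx
    have e1' : t₁ = 0 := by linarith
    have e2' : t₂ = 0 := by linarith
    have e3' : t₃ = 0 := by linarith
    exact ⟨t₀, by simp [comb, e1', e2', e3']⟩
  obtain ⟨A, hA⟩ := hrat _ h0
  obtain ⟨C, hC⟩ := hrat _ h2
  obtain ⟨u, v, hu, hv⟩ : ∃ u v : ℚ, autCoeff H Q.gen h = comb r z w u v 0 0 ∧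
      autCoeff H (Q.gen ^ 3) h = comb r z w u (-v) 0 0 := by
    obtain ⟨t₀, t₁, t₂, t₃, ht⟩ := Q.exists_eq_comb (autCoeff H Q.gen h)
    rw [← h1, ht, gen_comb, gen_comb] at h3
    obtain ⟨-, -, e2, e3⟩ := Q.comb_injective h3
    have e2' : t₂ = 0 := by linarith
    have e3' : t₃ = 0 := by linarith
    subst e2' e3'
    exact ⟨t₀, t₁, ht, by rw [← h1, ht, gen_comb]; simp⟩
  refine ⟨A + C, 2 * u, A - C, 2 * v, fun t₀ t₁ t₂ t₃ => ?_⟩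
  rw [smul_eq_sum_autCoeff (K := ℚ), ← Q.gen_pow_bijective.sum_comp]
  simp only [Fin.sum_univ_four, Fin.val_zero, Fin.val_one, Fin.val_two, pow_zero, pow_one,
    show ((3 : Fin 4) : ℕ) = 3 from rfl]
  rw [hA, hC, hu, hv]
  simp only [pow_succ, pow_zero, AlgEquiv.mul_apply, AlgEquiv.one_apply, gen_comb]
  simp only [comb]
  push_cast
  linear_combination (2 * v * t₂ : L) * Q.r_mul_w - (2 * v * t₃ : L) * Q.r_mul_z

/-- All `(α, β, γ, δ)` occur: the action is faithful and `dim H = 4`. -/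
theorem exists_actsBy_eq (Q : IsCyclicQuartic a b c d r z w) (hHG : IsHopfGalois ℚ L H)
    (hnc : ¬ IsClassical ℚ L H) (α β γ δ : ℚ) : ∃ h : H, ActsBy b c r z w h α β γ δ := by
  have := Q.isGalois
  have := hHG.finite
  have hr : Module.finrank ℚ H = Module.finrank ℚ (Fin 4 → ℚ) := by
    rw [finrank_eq_of_bijective hHG.bijective, Q.finrank_eq]; simp
  let Ψ : H →ₗ[ℚ] (Fin 4 → ℚ) := LinearMap.pi fun i =>
    Q.basis.coord i ∘ₗ (Algebra.lsmul ℚ ℚ L : H →ₐ[ℚ] Module.End ℚ L).toLinearMap.flip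
      ((![1, r, z, z] : Fin 4 → L) i)
  have hcoord : ∀ t₀ t₁ t₂ t₃ : ℚ, ∀ i, Q.basis.repr (comb r z w t₀ t₁ t₂ t₃) i
      = (![t₀, t₁, t₂, t₃] : Fin 4 → ℚ) i := by
    intro t₀ t₁ t₂ t₃ i
    have h1 : comb r z w t₀ t₁ t₂ t₃ = ∑ i, ![t₀, t₁, t₂, t₃] i • Q.basis i := by
      have := comb_eq_sum (r := r) (z := z) (w := w) ![t₀, t₁, t₂, t₃]
      simpa [basis] using this.symm
    rw [h1, Q.basis.repr_sum_self]
  have hΨ : ∀ h α β γ δ, ActsBy b c r z w h α β γ δ →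
      Ψ h = ![α + β, α - β, γ + δ * c, -(δ * b)] := by
    intro h α β γ δ hh
    have e0 : h • (1 : L) = comb r z w (α + β) 0 0 0 := by
      simpa [comb] using hh 1 0 0 0
    have e1 : h • r = comb r z w 0 (α - β) 0 0 := by simpa [comb] using hh 0 1 0 0
    have e2 : h • z = comb r z w 0 0 (γ + δ * c) (-(δ * b)) := by
      simpa [comb] using hh 0 0 1 0
    ext i
    fin_cases i <;> simp [Ψ, e0, e1, e2, hcoord]
  have hb : (b : ℚ) ≠ 0 := Int.cast_ne_zero.2 Q.b_pos.ne'
  have hdet : ∀ {α β γ δ α' β' γ' δ' : ℚ},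
      (![α + β, α - β, γ + δ * c, -(δ * b)] : Fin 4 → ℚ)
        = ![α' + β', α' - β', γ' + δ' * c, -(δ' * b)] →
      α = α' ∧ β = β' ∧ γ = γ' ∧ δ = δ' := by
    intro α β γ δ α' β' γ' δ' h
    have i0 := congrFun h 0
    have i1 := congrFun h 1
    have i2 := congrFun h 2
    have i3 := congrFun h 3
    simp only [Matrix.cons_val] at i0 i1 i2 i3
    have hδ : δ = δ' := mul_right_cancel₀ hb (by linarith)
    subst hδ
    exact ⟨by linarith, by linarith, by linarith, rfl⟩
  have hinj : Function.Injective Ψ := by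
    intro g h hgh
    obtain ⟨α, β, γ, δ, hg⟩ := Q.exists_actsBy hHG hnc g
    obtain ⟨α', β', γ', δ', hh⟩ := Q.exists_actsBy hHG hnc h
    rw [hΨ _ _ _ _ _ hg, hΨ _ _ _ _ _ hh] at hgh
    obtain ⟨rfl, rfl, rfl, rfl⟩ := hdet hgh
    refine lsmul_injective hHG.bijective.1 (LinearMap.ext fun x => ?_)
    obtain ⟨t₀, t₁, t₂, t₃, rfl⟩ := Q.exists_eq_comb x
    exact (hg t₀ t₁ t₂ t₃).trans (hh t₀ t₁ t₂ t₃).symm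
  obtain ⟨h, hh⟩ := (LinearMap.injective_iff_surjective_of_finrank_eq_finrank hr).1 hinj
    ![α + β, α - β, γ + δ * c, -(δ * b)]
  obtain ⟨α', β', γ', δ', ha⟩ := Q.exists_actsBy hHG hnc h
  rw [hΨ _ _ _ _ _ ha] at hh
  obtain ⟨rfl, rfl, rfl, rfl⟩ := hdet hh
  exact ⟨h, ha⟩

end IsCyclicQuartic

/-! ### Free generators over associated orders -/

section FreeGenerator

variable {L : Type*} [Field L] [NumberField L]
  {H : Type*} [Ring H] [Algebra ℚ H] [Module H L] [IsScalarTower ℚ H L]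

omit [NumberField L] [Algebra ℚ H] [IsScalarTower ℚ H L] in
theorem IsFreeGenerator.free {β : L} (hβ : IsFreeGenerator H β) :
    Module.Free (associatedOrder H L) (𝓞 L) := by
  obtain ⟨β', -, hbij⟩ := hβ
  exact Module.Free.of_equiv
    (LinearEquiv.ofBijective (LinearMap.toSpanSingleton (associatedOrder H L) (𝓞 L) β') hbij)

variable (H) in
/-- Evaluation `h ↦ h • β`, as a `ℚ`-linear map. -/
def evalAt (β : L) : H →ₗ[ℚ] L := (LinearMap.toSpanSingleton H L β).restrictScalars ℚ

theorem evalAt_apply (β : L) (h : H) : evalAt H β h = h • β := rfl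

theorem exists_zsmul_isIntegral (x : L) : ∃ N : ℤ, N ≠ 0 ∧ IsIntegral ℤ (N • x) := by
  obtain ⟨y, hy, h⟩ := exists_integral_multiples ℤ ℚ ({x} : Finset L)
  exact ⟨y, hy, h x (Finset.mem_singleton_self x)⟩

omit [Algebra ℚ H] [IsScalarTower ℚ H L] in
/-- Every element of `H` has a non-zero integral multiple in the associated order. -/
theorem exists_zsmul_mem_associatedOrder (h : H) :
    ∃ N : ℤ, N ≠ 0 ∧ N • h ∈ associatedOrder H L := by
  classical
  let B := NumberField.RingOfIntegers.basis L
  obtain ⟨N, hN, hint⟩ := exists_integral_multiples ℤ ℚ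
    (Finset.univ.image fun i => h • (B i : L))
  refine ⟨N, hN, fun x hx => ?_⟩
  have h1 := congrArg (algebraMap (𝓞 L) L) (B.sum_repr ⟨x, hx⟩)
  rw [map_sum] at h1
  change _ = x at h1
  rw [← h1, Finset.smul_sum]
  refine IsIntegral.sum _ fun i _ => ?_
  have h2 : (N • h) • (algebraMap (𝓞 L) L (B.repr ⟨x, hx⟩ i • B i))
      = (B.repr ⟨x, hx⟩ i) • (N • h • (B i : L)) := by
    rw [map_zsmul, smul_assoc, smul_comm h (B.repr ⟨x, hx⟩ i), smul_comm N]
  rw [h2]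
  exact (hint _ (Finset.mem_image_of_mem _ (Finset.mem_univ i))).smul _

/-- If `𝔄 β` is all of `𝓞 L`, then `H β = L`, so `h ↦ h β` is injective by dimension. -/
theorem isFreeGenerator_of_surjective [Module.Finite ℚ H]
    (hrank : Module.finrank ℚ H = Module.finrank ℚ L) {β : L} (hβ : IsIntegral ℤ β)
    (hsurj : ∀ x : L, IsIntegral ℤ x → ∃ h ∈ associatedOrder H L, h • β = x) :
    IsFreeGenerator H β := by
  have hs : Function.Surjective (evalAt H β) := by
    intro x
    obtain ⟨N, hN, hx⟩ := exists_zsmul_isIntegral x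
    obtain ⟨h, -, hh⟩ := hsurj _ hx
    refine ⟨(N : ℚ)⁻¹ • h, ?_⟩
    rw [map_smul, evalAt_apply, hh, ← Int.cast_smul_eq_zsmul ℚ N x, smul_smul,
      inv_mul_cancel₀ (Int.cast_ne_zero.2 hN), one_smul]
  have hi := (LinearMap.injective_iff_surjective_of_finrank_eq_finrank hrank).2 hs
  refine ⟨⟨β, hβ⟩, rfl, fun g h hgh => Subtype.ext (hi ?_), fun x => ?_⟩
  · exact congrArg (algebraMap (𝓞 L) L) hgh
  · obtain ⟨h, hh, e⟩ := hsurj x x.2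
    exact ⟨⟨h, hh⟩, Subtype.ext e⟩

/-- A free `𝔄`-module structure on `𝓞 L` has rank one, because `dim H = dim L`. -/
theorem exists_surjective_of_free [Module.Finite ℚ H]
    (hrank : Module.finrank ℚ H = Module.finrank ℚ L)
    [Module.Free (associatedOrder H L) (𝓞 L)] :
    ∃ β : L, IsIntegral ℤ β ∧
      ∀ x : L, IsIntegral ℤ x → ∃ h ∈ associatedOrder H L, h • β = x := by
  have hH : Nontrivial H := by
    refine Module.nontrivial_of_finrank_pos (R := ℚ) ?_
    rw [hrank]; exact Module.finrank_pos
  let B := Module.Free.chooseBasis (associatedOrder H L) (𝓞 L)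
  obtain ⟨i₀⟩ : Nonempty (Module.Free.ChooseBasisIndex (associatedOrder H L) (𝓞 L)) :=
    B.index_nonempty
  have hinj : Function.Injective (evalAt H (B i₀ : L)) := by
    rw [injective_iff_map_eq_zero]
    intro h hh
    obtain ⟨N, hN, hmem⟩ := exists_zsmul_mem_associatedOrder (L := L) h
    have h1 : (⟨N • h, hmem⟩ : associatedOrder H L) • B i₀ = 0 := by
      refine Subtype.ext ?_
      change (N • h) • (B i₀ : L) = 0
      rw [smul_assoc, ← evalAt_apply (H := H), hh, smul_zero]
    have h2 := congrArg (fun y => B.repr y i₀) h1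
    simp only [map_smul, Module.Basis.repr_self, Finsupp.smul_apply, Finsupp.single_eq_same,
      smul_eq_mul, mul_one, map_zero, Finsupp.zero_apply] at h2
    have h3 : N • h = 0 := congrArg Subtype.val h2
    rw [← Int.cast_smul_eq_zsmul ℚ] at h3
    exact (smul_eq_zero.1 h3).resolve_left (Int.cast_ne_zero.2 hN)
  have hsurj := (LinearMap.injective_iff_surjective_of_finrank_eq_finrank hrank).1 hinj
  have hsub : ∀ i, i = i₀ := by
    intro i
    by_contra hne
    obtain ⟨h, hh⟩ := hsurj (B i)
    obtain ⟨N, hN, hmem⟩ := exists_zsmul_mem_associatedOrder (L := L) h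
    have h1 : (⟨N • h, hmem⟩ : associatedOrder H L) • B i₀ = (N : associatedOrder H L) • B i := by
      refine Subtype.ext ?_
      change (N • h) • (B i₀ : L) = ((N : associatedOrder H L) : H) • (B i : L)
      rw [smul_assoc, ← evalAt_apply (H := H), hh]
      simp [Int.cast_smul_eq_zsmul]
    have h2 := congrArg (fun y => B.repr y i) h1
    simp only [map_smul, Module.Basis.repr_self, Finsupp.smul_apply, Finsupp.single_eq_same,
      smul_eq_mul, mul_one, Finsupp.single_eq_of_ne hne, mul_zero] at h2
    have h3 : ((N : ℤ) : H) = 0 := by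
      have := congrArg Subtype.val h2
      simpa using this.symm
    have h4 : algebraMap ℚ H (N : ℚ) = 0 := by rw [map_intCast, h3]
    rw [map_eq_zero_iff _ (algebraMap ℚ H).injective] at h4
    exact hN (by exact_mod_cast h4)
  refine ⟨B i₀, (B i₀).2, fun x hx => ?_⟩
  refine ⟨(B.repr ⟨x, hx⟩ i₀ : associatedOrder H L), (B.repr ⟨x, hx⟩ i₀).2, ?_⟩
  have h1 : B.repr ⟨x, hx⟩ i₀ • B i₀ = ⟨x, hx⟩ := by
    refine B.repr.injective (Finsupp.ext fun i => ?_)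
    rw [hsub i]
    simp
  exact congrArg (algebraMap (𝓞 L) L) h1

end FreeGenerator

/-! ### Lattices with congruence conditions -/

/-- The element `i f₁ + j f₂ + m e₁ + n e₂`. -/
def vec {L : Type*} [Field L] [CharZero L] (f₁ f₂ e₁ e₂ : L) (i j m n : ℚ) : L :=
  i * f₁ + j * f₂ + m * e₁ + n * e₂

/-- A common description of the ring of integers and of the action in all cases. With respect to
the `ℚ`-basis `f₁, f₂, e₁, e₂` of `L`, the ring of integers is the lattice of integral vectors
`(i, j, m, n)` with `i ≡ m` and `j ≡ n` modulo `k`, and the elements of `H` act as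
`(α + β τ) ⊕ (γ + δ ρ)`, where `τ f₁ = f₂`, `τ f₂ = v f₁ + u f₂`, `ρ e₁ = -q e₁ + p e₂` and
`ρ e₂ = p e₁ + q e₂`. The congruences for `p, q, u, v` say that `τ ⊕ ρ` induces
`(i, j, m, n) ↦ (j, i, n, m)` modulo `k`, so that it preserves the lattice. -/
structure IsLatticeModel {L : Type*} [Field L] [NumberField L] (H : Type*) [Ring H] [Algebra ℚ H]
    [Module H L] (f₁ f₂ e₁ e₂ : L) (p q u v : ℤ) (k : ℕ) : Prop where
  k_ne_zero : k ≠ 0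
  odd_p : Odd p
  coprime : IsCoprime p q
  p_mod : (p : ZMod k) = 1
  q_mod : (q : ZMod k) = 0
  u_mod : (u : ZMod k) = 0
  v_mod : (v : ZMod k) = 1
  finite : Module.Finite ℚ H
  finrank_eq : Module.finrank ℚ H = Module.finrank ℚ L
  inj : ∀ {i j m n i' j' m' n' : ℚ}, vec f₁ f₂ e₁ e₂ i j m n = vec f₁ f₂ e₁ e₂ i' j' m' n' →
    i = i' ∧ j = j' ∧ m = m' ∧ n = n'
  isIntegral_iff : ∀ x : L, IsIntegral ℤ x ↔ ∃ i j m n : ℤ, (i : ZMod k) = m ∧ (j : ZMod k) = n ∧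
    x = vec f₁ f₂ e₁ e₂ i j m n
  exists_act : ∀ h : H, ∃ α β γ δ : ℚ, ∀ i j m n : ℚ, h • vec f₁ f₂ e₁ e₂ i j m n =
    vec f₁ f₂ e₁ e₂ (α * i + β * v * j) (β * i + (α + u * β) * j)
      ((γ - q * δ) * m + p * δ * n) (p * δ * m + (γ + q * δ) * n)
  exists_elt : ∀ α β γ δ : ℚ, ∃ h : H, ∀ i j m n : ℚ, h • vec f₁ f₂ e₁ e₂ i j m n =
    vec f₁ f₂ e₁ e₂ (α * i + β * v * j) (β * i + (α + u * β) * j)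
      ((γ - q * δ) * m + p * δ * n) (p * δ * m + (γ + q * δ) * n)

namespace IsLatticeModel

variable {L : Type*} [Field L] [NumberField L] {H : Type*} [Ring H] [Algebra ℚ H] [Module H L]
  {f₁ f₂ e₁ e₂ : L} {p q u v : ℤ} {k : ℕ}

/-- The integral vectors `(α, β, γ, δ)` satisfying the congruences that define the lattice of `𝓞 L`
act by elements of the associated order. -/
theorem mem_associatedOrder (M : IsLatticeModel H f₁ f₂ e₁ e₂ p q u v k) {h : H} {α β γ δ : ℤ}
    (hh : ∀ i j m n : ℚ, h • vec f₁ f₂ e₁ e₂ i j m n =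
      vec f₁ f₂ e₁ e₂ (α * i + β * v * j) (β * i + (α + u * β) * j)
        ((γ - q * δ) * m + p * δ * n) (p * δ * m + (γ + q * δ) * n))
    (hα : (α : ZMod k) = γ) (hβ : (β : ZMod k) = δ) : h ∈ associatedOrder H L := by
  intro x hx
  obtain ⟨i, j, m, n, h1, h2, rfl⟩ := (M.isIntegral_iff x).1 hx
  refine (M.isIntegral_iff _).2 ⟨α * i + β * v * j, β * i + (α + u * β) * j,
    (γ - q * δ) * m + p * δ * n, p * δ * m + (γ + q * δ) * n, ?_, ?_, ?_⟩
  · push_cast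
    rw [hα, hβ, h1, h2, M.p_mod, M.q_mod, M.v_mod]
    ring
  · push_cast
    rw [hα, hβ, h1, h2, M.p_mod, M.q_mod, M.u_mod]
    ring
  · rw [hh]; push_cast; rfl

/-- An element of the associated order acts on `⟨e₁, e₂⟩` as `γ + δ ρ` with integers `γ, δ`:
the entries `γ ± q δ` and `p δ` are integral, and `2 q` and `p` are coprime. -/
theorem exists_int_of_mem (M : IsLatticeModel H f₁ f₂ e₁ e₂ p q u v k) {h : H} {α β γ δ : ℚ}
    (hh : ∀ i j m n : ℚ, h • vec f₁ f₂ e₁ e₂ i j m n =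
      vec f₁ f₂ e₁ e₂ (α * i + β * v * j) (β * i + (α + u * β) * j)
        ((γ - q * δ) * m + p * δ * n) (p * δ * m + (γ + q * δ) * n))
    (hmem : h ∈ associatedOrder H L) : ∃ γ' δ' : ℤ, γ = γ' ∧ δ = δ' := by
  have hk : (k : ℚ) ≠ 0 := Nat.cast_ne_zero.2 M.k_ne_zero
  have key : ∀ m n : ℤ, ∃ m' n' : ℤ, (γ - q * δ) * m + p * δ * n = m' ∧
      p * δ * m + (γ + q * δ) * n = n' := by
    intro m n
    -- The factor `k` makes the congruences with the zero coordinates hold.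
    have hx : IsIntegral ℤ (vec f₁ f₂ e₁ e₂ 0 0 (k * m) (k * n)) :=
      (M.isIntegral_iff _).2 ⟨0, 0, k * m, k * n, by simp, by simp, by push_cast; rfl⟩
    obtain ⟨i', j', m', n', h1, h2, e⟩ := (M.isIntegral_iff _).1 (hmem _ hx)
    rw [hh] at e
    obtain ⟨e1, e2, e3, e4⟩ := M.inj e
    have hi : i' = 0 := by
      have : (i' : ℚ) = 0 := by rw [← e1]; ring
      exact_mod_cast this
    have hj : j' = 0 := by
      have : (j' : ℚ) = 0 := by rw [← e2]; ring
      exact_mod_cast this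
    subst hi hj
    rw [Int.cast_zero, eq_comm, ZMod.intCast_zmod_eq_zero_iff_dvd] at h1 h2
    obtain ⟨m₁, rfl⟩ := h1
    obtain ⟨n₁, rfl⟩ := h2
    push_cast at e3 e4
    exact ⟨m₁, n₁, mul_left_cancel₀ hk (by linarith), mul_left_cancel₀ hk (by linarith)⟩
  obtain ⟨A, B, hA, hB⟩ := key 1 0
  obtain ⟨-, C, -, hC⟩ := key 0 1
  push_cast at hA hB hC
  obtain ⟨t, ht⟩ := M.odd_p
  obtain ⟨x, y, hxy⟩ : IsCoprime p (2 * q) :=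
    IsCoprime.mul_right ⟨1, -t, by rw [ht]; ring⟩ M.coprime
  have hxy' : (x : ℚ) * p + y * (2 * q) = 1 := by exact_mod_cast hxy
  have hδ : δ = ((x * B + y * (C - A) : ℤ) : ℚ) := by
    push_cast
    linear_combination (-δ) * hxy' + (x : ℚ) * hB + (y : ℚ) * (hC - hA)
  refine ⟨C - q * (x * B + y * (C - A)), _, ?_, hδ⟩
  rw [Int.cast_sub, Int.cast_mul, ← hδ]
  linear_combination hC

/-- If `𝓞 L` is free, the coordinates `(m, n)` of a generator in `⟨e₁, e₂⟩` generate the image of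
`𝓞 L` there, a copy of `ℤ²`, over `ℤ[ρ]`. So the determinant `p m² + 2 q m n - p n²` of
`(m, n), ρ (m, n)` is a unit. -/
theorem exists_form_eq_one [IsScalarTower ℚ H L] (M : IsLatticeModel H f₁ f₂ e₁ e₂ p q u v k)
    [Module.Free (associatedOrder H L) (𝓞 L)] :
    ∃ m n : ℤ, p * m ^ 2 + 2 * q * m * n - p * n ^ 2 = 1 := by
  have := M.finite
  obtain ⟨β, hβ, hsurj⟩ := exists_surjective_of_free (L := L) (H := H) M.finrank_eq
  obtain ⟨i, j, m, n, -, -, rfl⟩ := (M.isIntegral_iff β).1 hβ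
  have key : ∀ s t : ℤ, ∃ γ δ : ℤ, (γ - q * δ) * m + p * δ * n = s ∧
      p * δ * m + (γ + q * δ) * n = t := by
    intro s t
    have hx : IsIntegral ℤ (vec f₁ f₂ e₁ e₂ s t s t) :=
      (M.isIntegral_iff _).2 ⟨s, t, s, t, rfl, rfl, rfl⟩
    obtain ⟨h, hmem, e⟩ := hsurj _ hx
    obtain ⟨α, β, γ, δ, hh⟩ := M.exists_act h
    obtain ⟨γ', δ', rfl, rfl⟩ := M.exists_int_of_mem hh hmem
    rw [hh] at e
    obtain ⟨-, -, h3, h4⟩ := M.inj e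
    exact ⟨γ', δ', by exact_mod_cast h3, by exact_mod_cast h4⟩
  obtain ⟨γ₁, δ₁, h1, h2⟩ := key 1 0
  obtain ⟨γ₂, δ₂, h3, h4⟩ := key 0 1
  have hunit : (p * m ^ 2 + 2 * q * m * n - p * n ^ 2) * (γ₁ * δ₂ - γ₂ * δ₁) = 1 := by
    have : (p * m ^ 2 + 2 * q * m * n - p * n ^ 2) * (γ₁ * δ₂ - γ₂ * δ₁)
        = ((γ₁ - q * δ₁) * m + p * δ₁ * n) * (p * δ₂ * m + (γ₂ + q * δ₂) * n)
          - ((γ₂ - q * δ₂) * m + p * δ₂ * n) * (p * δ₁ * m + (γ₁ + q * δ₁) * n) := by ring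
    rw [this, h1, h2, h3, h4]; ring
  rcases Int.isUnit_iff.1 (IsUnit.of_mul_eq_one _ hunit) with h | h
  · exact ⟨m, n, h⟩
  · -- the rotation `(m, n) ↦ (n, -m)` changes the sign of the form.
    exact ⟨n, -m, by linear_combination -h⟩

/-- The elements of the lattice whose two determinants, for the action of `α + β τ` on `⟨f₁, f₂⟩`
and of `γ + δ ρ` on `⟨e₁, e₂⟩`, are units are free generators. -/
theorem isFreeGenerator [IsScalarTower ℚ H L] (M : IsLatticeModel H f₁ f₂ e₁ e₂ p q u v k)
    {i j m n ε : ℤ} (hi : (i : ZMod k) = m) (hj : (j : ZMod k) = n)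
    (hε : ε ^ 2 = 1) (hij : i ^ 2 + u * i * j - v * j ^ 2 = ε)
    (hmn : p * m ^ 2 + 2 * q * m * n - p * n ^ 2 = 1) :
    IsFreeGenerator H (vec f₁ f₂ e₁ e₂ i j m n) := by
  have := M.finite
  refine isFreeGenerator_of_surjective M.finrank_eq
    ((M.isIntegral_iff _).2 ⟨i, j, m, n, hi, hj, rfl⟩) fun x hx => ?_
  obtain ⟨I, J, S, T, hI, hJ, rfl⟩ := (M.isIntegral_iff x).1 hx
  have hεk : (ε : ZMod k) = 1 := by
    have h1 := congrArg (Int.cast : ℤ → ZMod k) hij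
    have h2 := congrArg (Int.cast : ℤ → ZMod k) hmn
    push_cast at h1 h2
    rw [hi, hj, M.u_mod, M.v_mod] at h1
    rw [M.p_mod, M.q_mod] at h2
    linear_combination h2 - h1
  -- `(α, β)` and `(γ, δ)` are found by Cramer's rule.
  obtain ⟨α, hα⟩ : ∃ α, α = ε * (I * (i + u * j) - J * v * j) := ⟨_, rfl⟩
  obtain ⟨β, hβ⟩ : ∃ β, β = ε * (i * J - j * I) := ⟨_, rfl⟩
  obtain ⟨γ, hγ⟩ : ∃ γ, γ = S * (p * m + q * n) - T * (p * n - q * m) := ⟨_, rfl⟩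
  obtain ⟨δ, hδ⟩ : ∃ δ, δ = m * T - n * S := ⟨_, rfl⟩
  obtain ⟨h, hh⟩ := M.exists_elt α β γ δ
  refine ⟨h, M.mem_associatedOrder hh ?_ ?_, ?_⟩
  · rw [hα, hγ]; push_cast
    rw [hεk, hI, hJ, hi, hj, M.p_mod, M.q_mod, M.u_mod, M.v_mod]; ring
  · rw [hβ, hδ]; push_cast
    rw [hεk, hI, hJ, hi, hj]; ring
  · rw [hh]
    have c1 : α * i + β * v * j = I := by
      rw [hα, hβ]; linear_combination ε * I * hij + I * hε
    have c2 : β * i + (α + u * β) * j = J := by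
      rw [hα, hβ]; linear_combination ε * J * hij + J * hε
    have c3 : (γ - q * δ) * m + p * δ * n = S := by
      rw [hγ, hδ]; linear_combination S * hmn
    have c4 : p * δ * m + (γ + q * δ) * n = T := by
      rw [hγ, hδ]; linear_combination T * hmn
    rw [← c1, ← c2, ← c3, ← c4]
    push_cast
    rfl

end IsLatticeModel

/-! ### Congruences for the coordinates of integral elements -/

theorem sq_mod_cases (x : ℤ) :
    (x % 2 = 0 ∧ ∃ s, x ^ 2 = 4 * s) ∨ (x % 2 = 1 ∧ ∃ s, x ^ 2 = 8 * s + 1) := by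
  rcases Int.even_or_odd' x with ⟨y, rfl | rfl⟩
  · exact Or.inl ⟨by omega, y ^ 2, by ring⟩
  · refine Or.inr ⟨by omega, ?_⟩
    obtain ⟨t, ht⟩ := (Int.even_mul_succ_self y)
    exact ⟨t, by linear_combination 4 * ht⟩

/-- The coordinates `T / 4` of an integral element when `d` is even. As in the other two lemmas of
this kind, the hypotheses express integrality of the trace and the norm to `ℚ(√d)`. -/
theorem coords_of_even {a b c d T₀ T₁ T₂ T₃ U V : ℤ} (ha : Odd a) (hb : Odd b) (hc : Odd c)
    (hd : d = b ^ 2 + c ^ 2) (h0 : 4 ∣ T₀ ^ 2 - d * T₁ ^ 2)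
    (hU : T₀ ^ 2 + d * T₁ ^ 2 - a * d * (T₂ ^ 2 + T₃ ^ 2) = 8 * U)
    (hV : 2 * T₀ * T₁ - a * b * (T₂ ^ 2 - T₃ ^ 2) - 2 * a * c * T₂ * T₃ = 8 * V)
    (hUV : 4 ∣ U ^ 2 - d * V ^ 2) : 4 ∣ T₀ ∧ 4 ∣ T₁ ∧ 4 ∣ T₂ ∧ 4 ∣ T₃ := by
  obtain ⟨D, hD⟩ : ∃ D, d = 4 * D + 2 := by
    obtain ⟨x, rfl⟩ := hb
    obtain ⟨y, rfl⟩ := hc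
    exact ⟨x ^ 2 + x + y ^ 2 + y, by rw [hd]; ring⟩
  have hpar : ∀ X Y : ℤ, 4 ∣ X ^ 2 - d * Y ^ 2 → (∃ x, X = 2 * x) ∧ ∃ y, Y = 2 * y := by
    intro X Y h
    rw [hD] at h
    rcases Int.even_or_odd' X with ⟨x, rfl | rfl⟩ <;> rcases Int.even_or_odd' Y with ⟨y, rfl | rfl⟩
    · exact ⟨⟨x, rfl⟩, ⟨y, rfl⟩⟩
    all_goals ring_nf at h; omega
  obtain ⟨⟨i, rfl⟩, ⟨j, rfl⟩⟩ := hpar _ _ h0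
  obtain ⟨⟨U, rfl⟩, ⟨V, rfl⟩⟩ := hpar _ _ hUV
  obtain ⟨x, rfl⟩ := ha
  obtain ⟨y, rfl⟩ := hb
  obtain ⟨t, rfl⟩ := hc
  clear hpar h0 hUV hd
  subst hD
  have h1 : (∃ m, T₂ = 2 * m) ∧ ∃ n, T₃ = 2 * n := by
    rcases Int.even_or_odd' T₂ with ⟨m, rfl | rfl⟩ <;>
      rcases Int.even_or_odd' T₃ with ⟨n, rfl | rfl⟩
    · exact ⟨⟨m, rfl⟩, ⟨n, rfl⟩⟩
    all_goals ring_nf at hV; omega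
  obtain ⟨⟨m, rfl⟩, ⟨n, rfl⟩⟩ := h1
  have hU' : i ^ 2 + (4 * D + 2) * j ^ 2 - (2 * x + 1) * (4 * D + 2) * (m ^ 2 + n ^ 2) = 4 * U := by
    linarith
  have hV' : 2 * i * j - (2 * x + 1) * (2 * y + 1) * (m ^ 2 - n ^ 2)
    - 2 * (2 * x + 1) * (2 * t + 1) * m * n = 4 * V := by linarith
  clear hU hV
  obtain ⟨i, rfl⟩ : ∃ i', i = 2 * i' := by
    rcases Int.even_or_odd' i with ⟨i, rfl | rfl⟩
    · exact ⟨i, rfl⟩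
    · ring_nf at hU'; omega
  have h1 : (∃ m', m = 2 * m') ∧ ∃ n', n = 2 * n' := by
    rcases Int.even_or_odd' m with ⟨m, rfl | rfl⟩ <;>
      rcases Int.even_or_odd' n with ⟨n, rfl | rfl⟩
    · exact ⟨⟨m, rfl⟩, ⟨n, rfl⟩⟩
    all_goals ring_nf at hV'; omega
  obtain ⟨⟨m, rfl⟩, ⟨n, rfl⟩⟩ := h1
  obtain ⟨j, rfl⟩ : ∃ j', j = 2 * j' := by
    rcases Int.even_or_odd' j with ⟨j, rfl | rfl⟩
    · exact ⟨j, rfl⟩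
    · ring_nf at hU'; omega
  omega

/-- The coordinates `T / 4` of an integral element when `b` is odd and `c` is even. -/
theorem coords_of_odd {a b c d T₀ T₁ T₂ T₃ U V : ℤ} (ha : Odd a) (hb : Odd b) (hc : Even c)
    (hd : d = b ^ 2 + c ^ 2) (h0 : 4 ∣ T₀ ^ 2 - d * T₁ ^ 2)
    (hU : T₀ ^ 2 + d * T₁ ^ 2 - a * d * (T₂ ^ 2 + T₃ ^ 2) = 8 * U)
    (hV : 2 * T₀ * T₁ - a * b * (T₂ ^ 2 - T₃ ^ 2) - 2 * a * c * T₂ * T₃ = 8 * V)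
    (hUV : 4 ∣ U ^ 2 - d * V ^ 2) :
    ∃ i j m n : ℤ, T₀ = 2 * (i + j) ∧ T₁ = 2 * (i - j) ∧ T₂ = 4 * m ∧ T₃ = 4 * n := by
  obtain ⟨D, hD⟩ : ∃ D, d = 4 * D + 1 := by
    obtain ⟨x, rfl⟩ := hb
    obtain ⟨y, rfl⟩ := hc
    exact ⟨x ^ 2 + x + y ^ 2, by rw [hd]; ring⟩
  have hpar : ∀ X Y : ℤ, 4 ∣ X ^ 2 - d * Y ^ 2 → ∃ x, X = Y + 2 * x := by
    intro X Y h
    rw [hD] at h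
    rcases Int.even_or_odd' X with ⟨x, rfl | rfl⟩ <;> rcases Int.even_or_odd' Y with ⟨y, rfl | rfl⟩
    · exact ⟨x - y, by ring⟩
    · ring_nf at h; omega
    · ring_nf at h; omega
    · exact ⟨x - y, by ring⟩
  obtain ⟨e, rfl⟩ := hpar _ _ h0
  obtain ⟨f, rfl⟩ := hpar _ _ hUV
  obtain ⟨x, rfl⟩ := ha
  obtain ⟨y, rfl⟩ := hb
  obtain ⟨t, rfl⟩ := hc
  clear hpar h0 hUV hd
  subst hD
  have h1 : (∃ m, T₂ = 2 * m) ∧ ∃ n, T₃ = 2 * n := by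
    rcases Int.even_or_odd' T₂ with ⟨m, rfl | rfl⟩ <;>
      rcases Int.even_or_odd' T₃ with ⟨n, rfl | rfl⟩
    · exact ⟨⟨m, rfl⟩, ⟨n, rfl⟩⟩
    · ring_nf at hV; omega
    · ring_nf at hV; omega
    · rcases Int.even_or_odd' T₁ with ⟨j, rfl | rfl⟩
      · ring_nf at hU; omega
      · ring_nf at hV; omega
  obtain ⟨⟨m, rfl⟩, ⟨n, rfl⟩⟩ := h1
  obtain ⟨j, rfl⟩ : ∃ j, T₁ = 2 * j := by
    rcases Int.even_or_odd' T₁ with ⟨j, rfl | rfl⟩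
    · exact ⟨j, rfl⟩
    · ring_nf at hV; omega
  have hU' : (j + e) ^ 2 + (4 * D + 1) * j ^ 2
      - (2 * x + 1) * (4 * D + 1) * (m ^ 2 + n ^ 2) = 2 * (V + 2 * f) := by linarith
  have hV' : 2 * (j + e) * j - (2 * x + 1) * (2 * y + 1) * (m ^ 2 - n ^ 2)
      - 2 * (2 * x + 1) * (t + t) * m * n = 2 * V := by linarith
  clear hU hV
  have h1 : (∃ m', m = 2 * m') ∧ ∃ n', n = 2 * n' := by
    rcases Int.even_or_odd' m with ⟨m, rfl | rfl⟩ <;>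
      rcases Int.even_or_odd' n with ⟨n, rfl | rfl⟩
    · exact ⟨⟨m, rfl⟩, ⟨n, rfl⟩⟩
    · ring_nf at hV'; omega
    · ring_nf at hV'; omega
    · rcases Int.even_or_odd' j with ⟨j, rfl | rfl⟩ <;>
        rcases Int.even_or_odd' e with ⟨e, rfl | rfl⟩ <;> ring_nf at hU' hV' <;> omega
  obtain ⟨⟨m, rfl⟩, ⟨n, rfl⟩⟩ := h1
  obtain ⟨e, rfl⟩ : ∃ e', e = 2 * e' := by
    rcases Int.even_or_odd' e with ⟨e, rfl | rfl⟩
    · exact ⟨e, rfl⟩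
    · rcases Int.even_or_odd' j with ⟨j, rfl | rfl⟩ <;> ring_nf at hU' <;> omega
  exact ⟨j + e, e, m, n, by ring, by ring, by ring, by ring⟩

/-- The coordinates of an integral element with respect to `ω/2, ω'/2, E₁/2, E₂/2` when `b` is
even. -/
theorem coords_of_b_even {a b c d T₀ T₁ T₂ T₃ U V : ℤ} (ha : Odd a) (hb : Even b) (hc : Odd c)
    (hd : d = b ^ 2 + c ^ 2) (h0 : 4 ∣ T₀ ^ 2 - d * T₁ ^ 2)
    (hU : T₀ ^ 2 + d * T₁ ^ 2 - a * d * (T₂ ^ 2 + T₃ ^ 2) = 8 * U)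
    (hV : 2 * T₀ * T₁ - a * b * (T₂ ^ 2 - T₃ ^ 2) - 2 * a * c * T₂ * T₃ = 8 * V)
    (hUV : 4 ∣ U ^ 2 - d * V ^ 2) :
    ∃ i j m n : ℤ, T₀ = i + j ∧ T₁ = i - j ∧ T₂ = m + n ∧ T₃ = m - n ∧
      (a + b ≡ 3 [ZMOD 4] → 2 ∣ i ∧ 2 ∣ j ∧ 2 ∣ m ∧ 2 ∣ n) ∧
      (a + b ≡ 1 [ZMOD 4] → a ≡ c [ZMOD 4] → 2 ∣ i - m ∧ 2 ∣ j - n) ∧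
      (a + b ≡ 1 [ZMOD 4] → a ≡ -c [ZMOD 4] → 2 ∣ i - n ∧ 2 ∣ j - m) := by
  obtain ⟨β, rfl⟩ := hb
  obtain ⟨x, hx⟩ := ha
  obtain ⟨t, rfl⟩ := hc
  obtain ⟨ε, hε⟩ : ∃ ε, d = 4 * ε + 1 := ⟨β ^ 2 + t ^ 2 + t, by rw [hd]; ring⟩
  obtain ⟨σ, hσ⟩ : ∃ σ, ε = β + 2 * σ := by
    obtain ⟨k, hk⟩ := Int.even_mul_succ_self t
    obtain ⟨l, hl⟩ := Int.even_mul_pred_self β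
    exact ⟨k + l, by linarith⟩
  have hpar : ∀ X Y : ℤ, 4 ∣ X ^ 2 - d * Y ^ 2 → ∃ x, X = Y + 2 * x := by
    intro X Y h
    rw [hε] at h
    rcases Int.even_or_odd' X with ⟨x, rfl | rfl⟩ <;> rcases Int.even_or_odd' Y with ⟨y, rfl | rfl⟩
    · exact ⟨x - y, by ring⟩
    · ring_nf at h; omega
    · ring_nf at h; omega
    · exact ⟨x - y, by ring⟩
  obtain ⟨j, rfl⟩ := hpar _ _ h0
  obtain ⟨f, rfl⟩ := hpar _ _ hUV
  obtain ⟨n, rfl⟩ : ∃ n, T₂ = T₃ + 2 * n := by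
    rw [hε, hx] at hU
    rcases Int.even_or_odd' T₂ with ⟨x, rfl | rfl⟩ <;>
      rcases Int.even_or_odd' T₃ with ⟨y, rfl | rfl⟩
    · exact ⟨x - y, by ring⟩
    · ring_nf at hU; omega
    · ring_nf at hU; omega
    · exact ⟨x - y, by ring⟩
  obtain ⟨i, rfl⟩ : ∃ i, T₁ = i - j := ⟨T₁ + j, by ring⟩
  obtain ⟨m, rfl⟩ : ∃ m, T₃ = m - n := ⟨T₃ + n, by ring⟩
  have hU4 : (2 * ε + 1) * (i ^ 2 + j ^ 2) - 4 * ε * (i * j)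
      - a * (4 * ε + 1) * (m ^ 2 + n ^ 2) = 4 * (V + 2 * f) := by
    rw [hε] at hU; linarith
  have hV4 : i ^ 2 - j ^ 2 - 4 * a * β * (m * n) - a * (2 * t + 1) * (m ^ 2 - n ^ 2) = 4 * V := by
    linarith
  clear hU hV h0 hUV hpar hd hε
  subst hσ
  -- What remains is a comparison of parities, with squares replaced by `4 s` or `8 s + 1`.
  refine ⟨i, j, m, n, by ring, rfl, by ring, rfl, fun hab => ?_, fun hab hac => ?_,
    fun hab hac => ?_⟩ <;> rw [Int.modEq_iff_dvd] at hab
  · subst hx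
    rcases sq_mod_cases i with ⟨hi, s₁, h₁⟩ | ⟨hi, s₁, h₁⟩ <;>
      rcases sq_mod_cases j with ⟨hj, s₂, h₂⟩ | ⟨hj, s₂, h₂⟩ <;>
      rcases sq_mod_cases m with ⟨hm, s₃, h₃⟩ | ⟨hm, s₃, h₃⟩ <;>
      rcases sq_mod_cases n with ⟨hn, s₄, h₄⟩ | ⟨hn, s₄, h₄⟩ <;>
      rw [h₁, h₂, h₃, h₄] at hU4 hV4
    · omega
    all_goals first
      | (ring_nf at hU4 hV4; omega)
      | skip
    -- The case of four odd coordinates is only excluded by comparing `U` and `V` modulo 2.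
    obtain ⟨y₁, h₅⟩ := (Int.odd_iff.2 hi).mul (Int.odd_iff.2 hj)
    obtain ⟨y₂, h₆⟩ := (Int.odd_iff.2 hm).mul (Int.odd_iff.2 hn)
    rw [h₅] at hU4
    rw [h₆] at hV4
    ring_nf at hU4 hV4
    omega
  all_goals
    obtain ⟨q, hq⟩ := hac.dvd
    obtain ⟨u, hu⟩ : ∃ u, (2 * t + 1) ^ 2 = 4 * u + 1 := ⟨t ^ 2 + t, by ring⟩
  · have hP : a * (2 * t + 1) = 4 * (u - q * (2 * t + 1)) + 1 := by
      linear_combination hu - (2 * t + 1) * hq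
    generalize u - q * (2 * t + 1) = P at hP
    rw [hP] at hV4
    clear hP hu hq hac
    subst hx
    rcases sq_mod_cases i with ⟨hi, s₁, h₁⟩ | ⟨hi, s₁, h₁⟩ <;>
      rcases sq_mod_cases j with ⟨hj, s₂, h₂⟩ | ⟨hj, s₂, h₂⟩ <;>
      rcases sq_mod_cases m with ⟨hm, s₃, h₃⟩ | ⟨hm, s₃, h₃⟩ <;>
      rcases sq_mod_cases n with ⟨hn, s₄, h₄⟩ | ⟨hn, s₄, h₄⟩ <;>
      rw [h₁, h₂, h₃, h₄] at hU4 hV4 <;> first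
      | omega
      | (ring_nf at hU4 hV4; omega)
  · have hP : a * (2 * t + 1) = 4 * (-u - q * (2 * t + 1)) - 1 := by
      linear_combination -hu - (2 * t + 1) * hq
    generalize -u - q * (2 * t + 1) = P at hP
    rw [hP] at hV4
    clear hP hu hq hac
    subst hx
    rcases sq_mod_cases i with ⟨hi, s₁, h₁⟩ | ⟨hi, s₁, h₁⟩ <;>
      rcases sq_mod_cases j with ⟨hj, s₂, h₂⟩ | ⟨hj, s₂, h₂⟩ <;>
      rcases sq_mod_cases m with ⟨hm, s₃, h₃⟩ | ⟨hm, s₃, h₃⟩ <;>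
      rcases sq_mod_cases n with ⟨hn, s₄, h₄⟩ | ⟨hn, s₄, h₄⟩ <;>
      rw [h₁, h₂, h₃, h₄] at hU4 hV4 <;> first
      | omega
      | (ring_nf at hU4 hV4; omega)

/-! ### Integral elements of a cyclic quartic field -/

theorem exists_int_of_squarefree_mul_sq {d : ℤ} (hd : Squarefree d) {x : ℚ}
    (h : ∃ n : ℤ, d * x ^ 2 = n) : ∃ m : ℤ, x = m := by
  obtain ⟨n, hn⟩ := h
  have hden : (x.den : ℚ) ≠ 0 := Nat.cast_ne_zero.2 x.den_nz
  have h1 : d * x.num ^ 2 = n * (x.den : ℤ) ^ 2 := by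
    have h2 : (x.num : ℚ) = x * x.den := (Rat.mul_den_eq_num x).symm
    have h3 : (d : ℚ) * (x.num : ℚ) ^ 2 = n * (x.den : ℚ) ^ 2 := by
      rw [h2, ← hn]; ring
    exact_mod_cast h3
  have hcop : IsCoprime ((x.den : ℤ) * x.den) (x.num ^ 2) := by
    have : IsCoprime (x.den : ℤ) x.num := by
      rw [Int.isCoprime_iff_gcd_eq_one, Int.gcd_comm]
      exact x.reduced
    exact (IsCoprime.mul_left this this).pow_right
  have h4 : (x.den : ℤ) * x.den ∣ d :=
    hcop.dvd_of_dvd_mul_right ⟨n, by rw [h1]; ring⟩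
  have h5 : x.den = 1 := by
    have := Int.isUnit_iff.1 (hd _ h4)
    omega
  exact ⟨x.num, by rw [← Rat.mul_den_eq_num x, h5]; simp⟩

theorem exists_int_of_isIntegral {L : Type*} [Field L] [NumberField L] {q : ℚ}
    (h : IsIntegral ℤ (q : L)) : ∃ n : ℤ, q = n := by
  have h1 : IsIntegral ℤ (algebraMap ℚ L q) := by simpa using h
  rw [isIntegral_algebraMap_iff (algebraMap ℚ L).injective,
    IsIntegrallyClosed.isIntegral_iff] at h1
  obtain ⟨n, hn⟩ := h1
  exact ⟨n, by simpa using hn.symm⟩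

/-- A root of a monic quadratic polynomial with integral coefficients is integral. -/
theorem isIntegral_of_sq_eq {L : Type*} [Field L] {x s t : L} (hs : IsIntegral ℤ s)
    (ht : IsIntegral ℤ t) (h : x ^ 2 = s * x + t) : IsIntegral ℤ x := by
  have h1 : IsIntegral (integralClosure ℤ L) x := by
    let s' : integralClosure ℤ L := ⟨s, hs⟩
    let t' : integralClosure ℤ L := ⟨t, ht⟩
    refine ⟨Polynomial.X ^ 2 - (Polynomial.C s' * Polynomial.X + Polynomial.C t'), ?_, ?_⟩
    · exact Polynomial.monic_X_pow_sub (Polynomial.degree_linear_le.trans_lt (by norm_num))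
    · simp only [Polynomial.eval₂_sub, Polynomial.eval₂_add, Polynomial.eval₂_mul,
        Polynomial.eval₂_pow, Polynomial.eval₂_X, Polynomial.eval₂_C]
      change x ^ 2 - (s * x + t) = 0
      rw [h, sub_self]
  exact isIntegral_trans x h1

namespace IsCyclicQuartic

variable {L : Type*} [Field L] [NumberField L] {a b c d : ℤ} {r z w : L}

theorem isIntegral_gen (Q : IsCyclicQuartic a b c d r z w) {x : L} (hx : IsIntegral ℤ x) :
    IsIntegral ℤ (Q.gen x) := hx.map (Q.gen.toAlgHom.restrictScalars ℤ)

theorem exists_of_isIntegral_quadratic (Q : IsCyclicQuartic a b c d r z w) {X Y : ℚ}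
    (h : IsIntegral ℤ (comb r z w X Y 0 0)) :
    ∃ m n : ℤ, 2 * X = m ∧ 2 * Y = n ∧ 4 ∣ m ^ 2 - d * n ^ 2 := by
  have h' := Q.isIntegral_gen h
  rw [gen_comb] at h'
  obtain ⟨m, hm⟩ := exists_int_of_isIntegral (L := L) (q := 2 * X) 
    ((congrArg (IsIntegral ℤ) (by simp only [comb]; push_cast; ring)).mp (h.add h'))
  obtain ⟨k, hk⟩ := exists_int_of_isIntegral (L := L) (q := X ^ 2 - d * Y ^ 2) 
    ((congrArg (IsIntegral ℤ) (by rw [Q.comb_mul]; simp only [comb]; push_cast; ring)).mp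
      (h.mul h'))
  obtain ⟨n, hn⟩ := exists_int_of_squarefree_mul_sq Q.squarefree_d (x := 2 * Y)
    ⟨m ^ 2 - 4 * k, by push_cast; rw [← hm, ← hk]; ring⟩
  refine ⟨m, n, hm, hn, k, ?_⟩
  have : (m : ℚ) ^ 2 - d * (n : ℚ) ^ 2 = 4 * k := by rw [← hm, ← hn, ← hk]; ring
  exact_mod_cast this

/-- The coordinates of an integral element are quarter integers, because the square of its part in
`⟨z, w⟩` is integral and `a d` is squarefree. The congruences express that the trace and the norm
to `ℚ(√d)` are integral. -/
theorem exists_of_isIntegral (Q : IsCyclicQuartic a b c d r z w) {x : L} (hx : IsIntegral ℤ x) :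
    ∃ T₀ T₁ T₂ T₃ U V : ℤ, x = comb r z w (T₀ / 4) (T₁ / 4) (T₂ / 4) (T₃ / 4) ∧
      4 ∣ T₀ ^ 2 - d * T₁ ^ 2 ∧
      T₀ ^ 2 + d * T₁ ^ 2 - a * d * (T₂ ^ 2 + T₃ ^ 2) = 8 * U ∧
      2 * T₀ * T₁ - a * b * (T₂ ^ 2 - T₃ ^ 2) - 2 * a * c * T₂ * T₃ = 8 * V ∧
      4 ∣ U ^ 2 - d * V ^ 2 := by
  obtain ⟨t₀, t₁, t₂, t₃, rfl⟩ := Q.exists_eq_comb x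
  have hx' := Q.isIntegral_gen (Q.isIntegral_gen hx)
  rw [gen_comb, gen_comb, neg_neg] at hx'
  have hd := Q.d_eq_cast (F := ℚ)
  obtain ⟨T₀, T₁, hT₀, hT₁, h01⟩ := Q.exists_of_isIntegral_quadratic (X := 2 * t₀) (Y := 2 * t₁)
    ((congrArg (IsIntegral ℤ) (by simp only [comb]; push_cast; ring)).mp (hx.add hx'))
  obtain ⟨U, V, hU, hV, hUV⟩ := Q.exists_of_isIntegral_quadratic
    (X := t₀ ^ 2 + d * t₁ ^ 2 - a * d * (t₂ ^ 2 + t₃ ^ 2))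
    (Y := 2 * t₀ * t₁ - a * b * (t₂ ^ 2 - t₃ ^ 2) - 2 * a * c * t₂ * t₃)
    ((congrArg (IsIntegral ℤ) (by rw [Q.comb_mul]; congr 1 <;> ring)).mp (hx.mul hx'))
  obtain ⟨A, B, hA, hB, k, hk⟩ := Q.exists_of_isIntegral_quadratic
    (X := 4 * (a * d * (t₂ ^ 2 + t₃ ^ 2)))
    (Y := 4 * (a * b * (t₂ ^ 2 - t₃ ^ 2) + 2 * a * c * t₂ * t₃)) (by
    refine (congrArg (IsIntegral ℤ) ?_).mp ((hx.sub hx').pow 2)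
    have : comb r z w t₀ t₁ t₂ t₃ - comb r z w t₀ t₁ (-t₂) (-t₃)
        = comb r z w 0 0 (2 * t₂) (2 * t₃) := by simp only [comb]; push_cast; ring
    rw [this, sq, Q.comb_mul]; congr 1 <;> ring)
  have hk' : (A : ℚ) ^ 2 - d * (B : ℚ) ^ 2 = 4 * k := by exact_mod_cast hk
  obtain ⟨Z, hZ⟩ := exists_int_of_squarefree_mul_sq Q.squarefree_d
    (x := 4 * a * (c * (t₂ ^ 2 - t₃ ^ 2) - 2 * b * t₂ * t₃)) ⟨k, by
      rw [← hA, ← hB] at hk'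
      linear_combination hk' / 4 - 16 * (a : ℚ) ^ 2 * d * (t₂ ^ 2 + t₃ ^ 2) ^ 2 * hd⟩
  have hsq : Squarefree (a * d) := squarefree_mul_iff.2
    ⟨Q.coprime.isRelPrime, Q.squarefree_a, Q.squarefree_d⟩
  have e1 : 8 * (a * d * (t₂ ^ 2 - t₃ ^ 2)) = b * B + 2 * c * Z := by
    rw [← hB, ← hZ]
    linear_combination 8 * (a : ℚ) * (t₂ ^ 2 - t₃ ^ 2) * hd
  have e2 : 8 * (a * d * (t₂ ^ 2 + t₃ ^ 2)) = A := by rw [← hA]; ring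
  obtain ⟨T₂, hT₂⟩ := exists_int_of_squarefree_mul_sq hsq (x := 4 * t₂)
    ⟨A + b * B + 2 * c * Z, by push_cast; linear_combination e1 + e2⟩
  obtain ⟨T₃, hT₃⟩ := exists_int_of_squarefree_mul_sq hsq (x := 4 * t₃)
    ⟨A - b * B - 2 * c * Z, by push_cast; linear_combination e2 - e1⟩
  have f0 : t₀ = T₀ / 4 := by linarith
  have f1 : t₁ = T₁ / 4 := by linarith
  have f2 : t₂ = T₂ / 4 := by linarith
  have f3 : t₃ = T₃ / 4 := by linarith
  rw [f0, f1, f2, f3] at hU hV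
  refine ⟨T₀, T₁, T₂, T₃, U, V, by rw [f0, f1, f2, f3], h01, ?_, ?_, hUV⟩
  · have : (T₀ : ℚ) ^ 2 + d * (T₁ : ℚ) ^ 2 - a * d * ((T₂ : ℚ) ^ 2 + (T₃ : ℚ) ^ 2) = 8 * U := by
      linear_combination 8 * hU
    exact_mod_cast this
  · have : 2 * (T₀ : ℚ) * T₁ - a * b * ((T₂ : ℚ) ^ 2 - (T₃ : ℚ) ^ 2) - 2 * a * c * T₂ * T₃
        = 8 * V := by linear_combination 8 * hV
    exact_mod_cast this

omit [NumberField L] in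
theorem isIntegral_intCast (n : ℤ) : IsIntegral ℤ (n : L) := by
  simpa using isIntegral_algebraMap (R := ℤ) (A := L) (x := n)

theorem isIntegral_r (Q : IsCyclicQuartic a b c d r z w) : IsIntegral ℤ r :=
  IsIntegral.of_pow two_pos (by rw [Q.r_sq]; exact isIntegral_intCast d)

theorem isIntegral_z (Q : IsCyclicQuartic a b c d r z w) : IsIntegral ℤ z :=
  IsIntegral.of_pow two_pos (by
    rw [Q.z_sq]
    exact (isIntegral_intCast a).mul
      ((isIntegral_intCast d).add ((isIntegral_intCast b).mul Q.isIntegral_r)))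

theorem isIntegral_w (Q : IsCyclicQuartic a b c d r z w) : IsIntegral ℤ w := by
  simpa [Q.gen_z] using Q.isIntegral_gen Q.isIntegral_z

theorem isIntegral_omega (Q : IsCyclicQuartic a b c d r z w) (hd : d % 4 = 1) :
    IsIntegral ℤ ((1 + r) / 2) := by
  obtain ⟨e, he⟩ : ∃ e, d = 4 * e + 1 := ⟨d / 4, by omega⟩
  refine isIntegral_of_sq_eq (isIntegral_intCast 1) (isIntegral_intCast e) ?_
  have h : (d : L) = 4 * e + 1 := by rw [he]; push_cast; rfl
  push_cast
  linear_combination (1 / 4 : L) * Q.r_sq + (1 / 4 : L) * h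

theorem isIntegral_omega' (Q : IsCyclicQuartic a b c d r z w) (hd : d % 4 = 1) :
    IsIntegral ℤ ((1 - r) / 2) := by
  have := Q.isIntegral_gen (Q.isIntegral_omega hd)
  rw [map_div₀, map_add, map_one, Q.gen_r, map_ofNat] at this
  rwa [← sub_eq_add_neg] at this

/-- `((z + w) / 2)² = a (d + c r) / 2`, which is integral when `c` and `d` are odd. -/
theorem isIntegral_half_add (Q : IsCyclicQuartic a b c d r z w) (hd : d % 4 = 1) (hc : Odd c) :
    IsIntegral ℤ ((z + w) / 2) := by
  obtain ⟨e, he⟩ : ∃ e, d = c + 2 * e := by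
    obtain ⟨t, rfl⟩ := hc
    exact ⟨(d - (2 * t + 1)) / 2, by omega⟩
  refine IsIntegral.of_pow two_pos ?_
  have h : ((z + w) / 2) ^ 2 = ((a * c : ℤ) : L) * ((1 + r) / 2) + ((a * e : ℤ) : L) := by
    have h : (d : L) = c + 2 * e := by rw [he]; push_cast; rfl
    push_cast
    linear_combination (1 / 4 : L) * Q.z_sq + (1 / 4 : L) * Q.w_sq + (1 / 2 : L) * Q.z_mul_w
      + (a / 2 : L) * h
  rw [h]
  exact ((isIntegral_intCast _).mul (Q.isIntegral_omega hd)).add (isIntegral_intCast _)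

theorem isIntegral_half_sub (Q : IsCyclicQuartic a b c d r z w) (hd : d % 4 = 1) (hc : Odd c) :
    IsIntegral ℤ ((z - w) / 2) := by
  have := (Q.isIntegral_gen (Q.isIntegral_half_add hd hc)).neg
  rw [map_div₀, map_add, Q.gen_z, Q.gen_w, map_ofNat] at this
  exact (congrArg (IsIntegral ℤ) (by ring)).mp this

/-- The extra integral elements `(1 + ε r + z + w) / 4` with `ε = ±1`, present when `b` is even,
`a + b ≡ 1` and `a ≡ ε c` modulo 4. -/
theorem isIntegral_quarter (Q : IsCyclicQuartic a b c d r z w) (hb : Even b) (ha : Odd a)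
    (hab : a + b ≡ 1 [ZMOD 4]) {ε : ℤ} (hε : ε = 1 ∨ ε = -1) (hac : a ≡ ε * c [ZMOD 4])
    (hd : d % 4 = 1) : IsIntegral ℤ ((1 + ε * r + z + w) / 4) := by
  have hε2 : ε ^ 2 = 1 := by rcases hε with rfl | rfl <;> norm_num
  obtain ⟨k, hk⟩ : ∃ k, c = ε * a + 4 * k := by
    obtain ⟨k, hk⟩ := hac.dvd
    exact ⟨ε * k, by linear_combination ε * hk - c * hε2⟩
  -- `d + 1 - 2 ε - 2 a d + 2 ε a c` is divisible by 16
  obtain ⟨A, hA⟩ : ∃ A, d - 2 * a * d + 1 + 2 * (ε * a * c) - 2 = 16 * A := by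
    obtain ⟨β, rfl⟩ := hb
    obtain ⟨j, hj⟩ := hab.symm.dvd
    have ha' : a = 1 - (β + β) + 4 * j := by linarith
    rw [Q.d_eq, hk]
    refine ⟨ε * a * k - ε * a ^ 2 * k + k ^ 2 - 2 * a * k ^ 2 - β ^ 2 - β ^ 2 * (2 * j - β)
      - 3 * j ^ 2 + 3 * j * β - (2 * j - β) ^ 3, ?_⟩
    have h : 4 * β ^ 2 * (1 - 2 * a) + 3 * a ^ 2 - 2 * a ^ 3 - 1 = 16 * (-β ^ 2
        - β ^ 2 * (2 * j - β) - 3 * j ^ 2 + 3 * j * β - (2 * j - β) ^ 3) := by rw [ha']; ring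
    linear_combination (a ^ 2 * (1 - 2 * a) + 2 * a ^ 2) * hε2 + h
  obtain ⟨B, hB⟩ : ∃ B, 1 - ε * a * c = 4 * B := by
    obtain ⟨x, rfl⟩ := ha
    refine ⟨-(x ^ 2 + x) - ε * (2 * x + 1) * k, ?_⟩
    rw [hk]
    linear_combination -(2 * x + 1) ^ 2 * hε2
  have hω : IsIntegral ℤ ((1 + ε * r) / 2) := by
    rcases hε with rfl | rfl
    · exact (congrArg (IsIntegral ℤ) (by push_cast; ring)).mp (Q.isIntegral_omega hd)
    · exact (congrArg (IsIntegral ℤ) (by push_cast; ring)).mp (Q.isIntegral_omega' hd)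
  refine isIntegral_of_sq_eq hω
    (((isIntegral_intCast A).add ((isIntegral_intCast B).mul hω)).neg) ?_
  have hA' : (d : L) - 2 * a * d + 1 + 2 * (ε * a * c) - 2 = 16 * A := by exact_mod_cast hA
  have hB' : (1 : L) - ε * a * c = 4 * B := by exact_mod_cast hB
  have hε' : (ε : L) ^ 2 = 1 := by exact_mod_cast hε2
  linear_combination (1 / 16 : L) * Q.z_sq + (1 / 16 : L) * Q.w_sq + (1 / 8 : L) * Q.z_mul_w
    - (ε ^ 2 / 16 : L) * Q.r_sq - (1 / 16 : L) * hA' - ((1 + ε * r) / 8 : L) * hB'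
    - (r * a * c / 8 + d / 16 : L) * hε'

end IsCyclicQuartic

/-! ### The lattice models of the ring of integers -/

namespace IsCyclicQuartic

variable {L : Type*} [Field L] [NumberField L] {a b c d : ℤ} {r z w : L}

theorem odd_of_even_d (Q : IsCyclicQuartic a b c d r z w) (hd : Even d) : Odd b ∧ Odd c := by
  obtain ⟨x, y, hxy⟩ := Q.isCoprime_b_c
  have h := Q.d_eq
  rcases Int.even_or_odd' b with ⟨s, hs | hs⟩ <;> rcases Int.even_or_odd' c with ⟨t, ht | ht⟩
  · exfalso
    have : 2 * (x * s + y * t) = 1 := by rw [← hxy, hs, ht]; ring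
    omega
  · exfalso
    obtain ⟨e, he⟩ := hd
    rw [he, hs, ht] at h; ring_nf at h; omega
  · exfalso
    obtain ⟨e, he⟩ := hd
    rw [he, hs, ht] at h; ring_nf at h; omega
  · exact ⟨⟨s, hs⟩, ⟨t, ht⟩⟩

theorem odd_c_of_even_b (Q : IsCyclicQuartic a b c d r z w) (hb : Even b) : Odd c := by
  rw [← Int.not_even_iff_odd]
  intro hc
  exact Int.not_even_iff_odd.2 (Q.odd_of_even_d (by
    rw [Q.d_eq]; exact (hb.pow_of_ne_zero two_ne_zero).add (hc.pow_of_ne_zero two_ne_zero))).1 hb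

theorem d_mod_four (Q : IsCyclicQuartic a b c d r z w) (hd : Odd d) : d % 4 = 1 := by
  have h := Q.d_eq
  rcases Int.even_or_odd' b with ⟨s, hs | hs⟩ <;> rcases Int.even_or_odd' c with ⟨t, ht | ht⟩ <;>
    obtain ⟨e, he⟩ := hd <;> rw [he, hs, ht] at h <;> ring_nf at h <;> omega

theorem odd_d_of_even_b (Q : IsCyclicQuartic a b c d r z w) (hb : Even b) : Odd d := by
  rw [← Int.not_even_iff_odd]
  intro hd
  exact Int.not_even_iff_odd.2 (Q.odd_of_even_d hd).1 hb

variable {H : Type*} [Ring H] [HopfAlgebra ℚ H] [Module H L] [IsScalarTower ℚ H L]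

/-- For even `d` the ring of integers has the `ℤ`-basis `1, r, z, w`. The part `⟨1, r⟩`
is written in the basis `1 + r, 1`, on which `τ = (1 + (s + s³)/2)/2` acts by `1 + r ↦ 1 ↦ 1`.
The sign of `ρ` is opposite to the one in `ActsBy`. -/
theorem isLatticeModel_of_even_d (Q : IsCyclicQuartic a b c d r z w) (hHG : IsHopfGalois ℚ L H)
    (hnc : ¬ IsClassical ℚ L H) (hd : Even d) :
    IsLatticeModel H (1 + r) 1 z w b c 1 0 1 := by
  have := Q.isGalois
  have := hHG.finite
  obtain ⟨hb, hc⟩ := Q.odd_of_even_d hd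
  have hvec : ∀ i j m n : ℚ, vec (1 + r) 1 z w i j m n = comb r z w (i + j) i m n := by
    intro i j m n; simp only [vec, comb]; push_cast; ring
  refine
    { k_ne_zero := one_ne_zero, odd_p := hb, coprime := Q.isCoprime_b_c
      p_mod := Subsingleton.elim _ _, q_mod := Subsingleton.elim _ _
      u_mod := Subsingleton.elim _ _, v_mod := Subsingleton.elim _ _
      finite := hHG.finite, finrank_eq := finrank_eq_of_bijective hHG.bijective
      inj := ?_, isIntegral_iff := ?_, exists_act := ?_, exists_elt := ?_ }
  · intro i j m n i' j' m' n' h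
    rw [hvec, hvec] at h
    obtain ⟨h1, h2, h3, h4⟩ := Q.comb_injective h
    exact ⟨h2, by linarith, h3, h4⟩
  · intro x
    constructor
    · intro hx
      obtain ⟨T₀, T₁, T₂, T₃, U, V, rfl, h0, hU, hV, hUV⟩ := Q.exists_of_isIntegral hx
      obtain ⟨⟨i, rfl⟩, ⟨j, rfl⟩, ⟨m, rfl⟩, ⟨n, rfl⟩⟩ :=
        coords_of_even Q.odd_a hb hc Q.d_eq h0 hU hV hUV
      refine ⟨j, i - j, m, n, Subsingleton.elim _ _, Subsingleton.elim _ _, ?_⟩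
      rw [hvec]
      congr 1 <;> push_cast <;> ring
    · rintro ⟨i, j, m, n, -, -, rfl⟩
      simp only [vec, Rat.cast_intCast]
      exact ((((isIntegral_intCast i).mul (isIntegral_one.add Q.isIntegral_r)).add
        ((isIntegral_intCast j).mul isIntegral_one)).add
        ((isIntegral_intCast m).mul Q.isIntegral_z)).add ((isIntegral_intCast n).mul Q.isIntegral_w)
  · intro h
    obtain ⟨α, β, γ, δ, hh⟩ := Q.exists_actsBy hHG hnc h
    refine ⟨α - β, 2 * β, γ, -δ, fun i j m n => ?_⟩
    rw [hvec, hh, hvec]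
    congr 1 <;> push_cast <;> ring
  · intro α β γ δ
    obtain ⟨h, hh⟩ := Q.exists_actsBy_eq hHG hnc (α + β / 2) (β / 2) γ (-δ)
    refine ⟨h, fun i j m n => ?_⟩
    rw [hvec, hh, hvec]
    congr 1 <;> push_cast <;> ring

/-- For odd `d` and `b` the ring of integers has the `ℤ`-basis `(1 + r)/2, (1 - r)/2, z, w`. The
sign of `ρ` is opposite to the one in `ActsBy`. -/
theorem isLatticeModel_of_odd_b (Q : IsCyclicQuartic a b c d r z w) (hHG : IsHopfGalois ℚ L H)
    (hnc : ¬ IsClassical ℚ L H) (hd : Odd d) (hb : Odd b) :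
    IsLatticeModel H ((1 + r) / 2) ((1 - r) / 2) z w b c 0 1 1 := by
  have := Q.isGalois
  have := hHG.finite
  have hd4 := Q.d_mod_four hd
  have hc : Even c := by
    rw [← Int.not_odd_iff_even]
    intro hc
    exact Int.not_even_iff_odd.2 hd (by rw [Q.d_eq]; exact hb.pow.add_odd hc.pow)
  have hvec : ∀ i j m n : ℚ, vec ((1 + r) / 2) ((1 - r) / 2) z w i j m n
      = comb r z w ((i + j) / 2) ((i - j) / 2) m n := by
    intro i j m n; simp only [vec, comb]; push_cast; ring
  refine
    { k_ne_zero := one_ne_zero, odd_p := hb, coprime := Q.isCoprime_b_c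
      p_mod := Subsingleton.elim _ _, q_mod := Subsingleton.elim _ _
      u_mod := Subsingleton.elim _ _, v_mod := Subsingleton.elim _ _
      finite := hHG.finite, finrank_eq := finrank_eq_of_bijective hHG.bijective
      inj := ?_, isIntegral_iff := ?_, exists_act := ?_, exists_elt := ?_ }
  · intro i j m n i' j' m' n' h
    rw [hvec, hvec] at h
    obtain ⟨h1, h2, h3, h4⟩ := Q.comb_injective h
    exact ⟨by linarith, by linarith, h3, h4⟩
  · intro x
    constructor
    · intro hx
      obtain ⟨T₀, T₁, T₂, T₃, U, V, rfl, h0, hU, hV, hUV⟩ := Q.exists_of_isIntegral hx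
      obtain ⟨i, j, m, n, rfl, rfl, rfl, rfl⟩ :=
        coords_of_odd Q.odd_a hb hc Q.d_eq h0 hU hV hUV
      refine ⟨i, j, m, n, Subsingleton.elim _ _, Subsingleton.elim _ _, ?_⟩
      rw [hvec]
      congr 1 <;> push_cast <;> ring
    · rintro ⟨i, j, m, n, -, -, rfl⟩
      simp only [vec, Rat.cast_intCast]
      exact ((((isIntegral_intCast i).mul (Q.isIntegral_omega hd4)).add
        ((isIntegral_intCast j).mul (Q.isIntegral_omega' hd4))).add
        ((isIntegral_intCast m).mul Q.isIntegral_z)).add ((isIntegral_intCast n).mul Q.isIntegral_w)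
  · intro h
    obtain ⟨α, β, γ, δ, hh⟩ := Q.exists_actsBy hHG hnc h
    refine ⟨α, β, γ, -δ, fun i j m n => ?_⟩
    rw [hvec, hh, hvec]
    congr 1 <;> push_cast <;> ring
  · intro α β γ δ
    obtain ⟨h, hh⟩ := Q.exists_actsBy_eq hHG hnc α β γ (-δ)
    refine ⟨h, fun i j m n => ?_⟩
    rw [hvec, hh, hvec]
    congr 1 <;> push_cast <;> ring

/-- For even `b` and `a + b ≡ 3` modulo 4 the ring of integers has the `ℤ`-basis `(1 ± r)/2`,
`(z ± w)/2`. Passing from `z, w` to `(z ± w)/2` exchanges the roles of `b` and `c` in the matrix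
of `ρ`. -/
theorem isLatticeModel_of_add_eq_three (Q : IsCyclicQuartic a b c d r z w)
    (hHG : IsHopfGalois ℚ L H) (hnc : ¬ IsClassical ℚ L H) (hb : Even b)
    (hab : a + b ≡ 3 [ZMOD 4]) :
    IsLatticeModel H ((1 + r) / 2) ((1 - r) / 2) ((z + w) / 2) ((z - w) / 2) c b 0 1 1 := by
  have := Q.isGalois
  have := hHG.finite
  have hd4 := Q.d_mod_four (Q.odd_d_of_even_b hb)
  have hc := Q.odd_c_of_even_b hb
  have hvec : ∀ i j m n : ℚ,
      vec ((1 + r) / 2) ((1 - r) / 2) ((z + w) / 2) ((z - w) / 2) i j m n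
        = comb r z w ((i + j) / 2) ((i - j) / 2) ((m + n) / 2) ((m - n) / 2) := by
    intro i j m n; simp only [vec, comb]; push_cast; ring
  refine
    { k_ne_zero := one_ne_zero, odd_p := hc, coprime := Q.isCoprime_b_c.symm
      p_mod := Subsingleton.elim _ _, q_mod := Subsingleton.elim _ _
      u_mod := Subsingleton.elim _ _, v_mod := Subsingleton.elim _ _
      finite := hHG.finite, finrank_eq := finrank_eq_of_bijective hHG.bijective
      inj := ?_, isIntegral_iff := ?_, exists_act := ?_, exists_elt := ?_ }
  · intro i j m n i' j' m' n' h
    rw [hvec, hvec] at h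
    obtain ⟨h1, h2, h3, h4⟩ := Q.comb_injective h
    exact ⟨by linarith, by linarith, by linarith, by linarith⟩
  · intro x
    constructor
    · intro hx
      obtain ⟨T₀, T₁, T₂, T₃, U, V, rfl, h0, hU, hV, hUV⟩ := Q.exists_of_isIntegral hx
      obtain ⟨i, j, m, n, rfl, rfl, rfl, rfl, h3, -, -⟩ :=
        coords_of_b_even Q.odd_a hb hc Q.d_eq h0 hU hV hUV
      obtain ⟨⟨i, rfl⟩, ⟨j, rfl⟩, ⟨m, rfl⟩, ⟨n, rfl⟩⟩ := h3 hab
      refine ⟨i, j, m, n, Subsingleton.elim _ _, Subsingleton.elim _ _, ?_⟩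
      rw [hvec]
      congr 1 <;> push_cast <;> ring
    · rintro ⟨i, j, m, n, -, -, rfl⟩
      simp only [vec, Rat.cast_intCast]
      exact ((((isIntegral_intCast i).mul (Q.isIntegral_omega hd4)).add
        ((isIntegral_intCast j).mul (Q.isIntegral_omega' hd4))).add
        ((isIntegral_intCast m).mul (Q.isIntegral_half_add hd4 hc))).add
        ((isIntegral_intCast n).mul (Q.isIntegral_half_sub hd4 hc))
  · intro h
    obtain ⟨α, β, γ, δ, hh⟩ := Q.exists_actsBy hHG hnc h
    refine ⟨α, β, γ, δ, fun i j m n => ?_⟩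
    rw [hvec, hh, hvec]
    congr 1 <;> push_cast <;> ring
  · intro α β γ δ
    obtain ⟨h, hh⟩ := Q.exists_actsBy_eq hHG hnc α β γ δ
    refine ⟨h, fun i j m n => ?_⟩
    rw [hvec, hh, hvec]
    congr 1 <;> push_cast <;> ring

/-- The two cases with `a + b ≡ 1` modulo 4; the sign `ε` with `a ≡ ε c` decides which of
`(1 ± r) / 4` is paired with `(z + w) / 4`. -/
theorem isLatticeModel_of_add_eq_one (Q : IsCyclicQuartic a b c d r z w)
    (hHG : IsHopfGalois ℚ L H) (hnc : ¬ IsClassical ℚ L H) (hb : Even b)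
    (hab : a + b ≡ 1 [ZMOD 4]) {ε : ℤ} (hε : ε = 1 ∨ ε = -1) (hac : a ≡ ε * c [ZMOD 4]) :
    IsLatticeModel H ((1 + ε * r) / 4) ((1 - ε * r) / 4) ((z + w) / 4) ((z - w) / 4) c b 0 1 2 := by
  have := Q.isGalois
  have := hHG.finite
  have hd4 := Q.d_mod_four (Q.odd_d_of_even_b hb)
  have hc := Q.odd_c_of_even_b hb
  have hεε : (ε : ℚ) * ε = 1 := by rcases hε with rfl | rfl <;> norm_num
  have hvec : ∀ i j m n : ℚ,
      vec ((1 + ε * r) / 4) ((1 - ε * r) / 4) ((z + w) / 4) ((z - w) / 4) i j m n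
        = comb r z w ((i + j) / 4) (ε * (i - j) / 4) ((m + n) / 4) ((m - n) / 4) := by
    intro i j m n; simp only [vec, comb]; push_cast; ring
  have hquarter := Q.isIntegral_quarter hb Q.odd_a hab hε hac hd4
  have hquarter' : IsIntegral ℤ ((1 - ε * r + z - w) / 4) := by
    have h := (Q.isIntegral_gen hquarter).add (Q.isIntegral_half_sub hd4 hc)
    simp only [map_div₀, map_add, map_mul, map_one, map_ofNat, map_intCast, Q.gen_r, Q.gen_z,
      Q.gen_w] at h
    exact (congrArg (IsIntegral ℤ) (by ring)).mp h
  have hω : IsIntegral ℤ ((1 + ε * r) / 2) ∧ IsIntegral ℤ ((1 - ε * r) / 2) := by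
    rcases hε with rfl | rfl
    · simpa using ⟨Q.isIntegral_omega hd4, Q.isIntegral_omega' hd4⟩
    · simpa [← sub_eq_add_neg] using ⟨Q.isIntegral_omega' hd4, Q.isIntegral_omega hd4⟩
  refine
    { k_ne_zero := two_ne_zero, odd_p := hc, coprime := Q.isCoprime_b_c.symm
      p_mod := (ZMod.intCast_eq_one_iff_odd).2 hc, q_mod := (ZMod.intCast_eq_zero_iff_even).2 hb
      u_mod := by simp, v_mod := by simp
      finite := hHG.finite, finrank_eq := finrank_eq_of_bijective hHG.bijective
      inj := ?_, isIntegral_iff := ?_, exists_act := ?_, exists_elt := ?_ }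
  · intro i j m n i' j' m' n' h
    rw [hvec, hvec] at h
    obtain ⟨h1, h2, h3, h4⟩ := Q.comb_injective h
    have h5 : i - j = i' - j' := by linear_combination 4 * ε * h2 + (i' - j' - i + j) * hεε
    exact ⟨by linarith, by linarith, by linarith, by linarith⟩
  · intro x
    constructor
    · intro hx
      obtain ⟨T₀, T₁, T₂, T₃, U, V, rfl, h0, hU, hV, hUV⟩ := Q.exists_of_isIntegral hx
      obtain ⟨i, j, m, n, rfl, rfl, rfl, rfl, -, h1, h2⟩ :=
        coords_of_b_even Q.odd_a hb hc Q.d_eq h0 hU hV hUV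
      rcases hε with rfl | rfl
      · obtain ⟨h3, h4⟩ := h1 hab (by simpa using hac)
        refine ⟨i, j, m, n, ((ZMod.intCast_eq_intCast_iff_dvd_sub _ _ 2).2 h3).symm,
          ((ZMod.intCast_eq_intCast_iff_dvd_sub _ _ 2).2 h4).symm, ?_⟩
        rw [hvec]
        congr 1 <;> push_cast <;> ring
      · obtain ⟨h3, h4⟩ := h2 hab (by simpa using hac)
        refine ⟨j, i, m, n, ((ZMod.intCast_eq_intCast_iff_dvd_sub _ _ 2).2 h4).symm,
          ((ZMod.intCast_eq_intCast_iff_dvd_sub _ _ 2).2 h3).symm, ?_⟩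
        rw [hvec]
        congr 1 <;> push_cast <;> ring
    · rintro ⟨i, j, m, n, h1, h2, rfl⟩
      obtain ⟨s, hs⟩ := (ZMod.intCast_eq_intCast_iff_dvd_sub _ _ 2).1 h1.symm
      obtain ⟨t, ht⟩ := (ZMod.intCast_eq_intCast_iff_dvd_sub _ _ 2).1 h2.symm
      obtain rfl : i = m + 2 * s := by push_cast at hs; linarith
      obtain rfl : j = n + 2 * t := by push_cast at ht; linarith
      refine (congrArg (IsIntegral ℤ) ?_).mp
        (((((isIntegral_intCast s).mul hω.1).add ((isIntegral_intCast t).mul hω.2)).add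
        ((isIntegral_intCast m).mul hquarter)).add ((isIntegral_intCast n).mul hquarter'))
      simp only [vec]; push_cast; ring
  · intro h
    obtain ⟨α, β, γ, δ, hh⟩ := Q.exists_actsBy hHG hnc h
    refine ⟨α, β, γ, δ, fun i j m n => ?_⟩
    rw [hvec, hh, hvec]
    congr 1 <;> push_cast <;> ring
  · intro α β γ δ
    obtain ⟨h, hh⟩ := Q.exists_actsBy_eq hHG hnc α β γ δ
    refine ⟨h, fun i j m n => ?_⟩
    rw [hvec, hh, hvec]
    congr 1 <;> push_cast <;> ring

end IsCyclicQuartic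

/-! ### The norm equation -/

/-- With `x = p u + q y`, the norm `x² - d y²` is `p` times the form `p u² + 2 q u y - p y²`. -/
theorem form_eq_one {p q d x y u : ℤ} (hp : 0 < p) (hd : d = p ^ 2 + q ^ 2)
    (h1 : x ^ 2 - d * y ^ 2 = p) (h2 : x - q * y = p * u) :
    p * u ^ 2 + 2 * q * u * y - p * y ^ 2 = 1 := by
  obtain rfl : x = p * u + q * y := by linarith
  refine mul_left_cancel₀ hp.ne' ?_
  linear_combination h1 + y ^ 2 * hd

theorem exists_of_form_eq_one {p q d m n : ℤ} (hd : d = p ^ 2 + q ^ 2)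
    (h : p * m ^ 2 + 2 * q * m * n - p * n ^ 2 = 1) :
    ∃ x y : ℤ, x ^ 2 - d * y ^ 2 = p ∧ p ∣ x - q * y :=
  ⟨p * m + q * n, n, by rw [hd]; linear_combination p * h, m, by ring⟩

end HopfGalois

open HopfGalois

theorem mainTheorem1 {L : Type*} [Field L] [NumberField L]
    (a b c d : ℤ) (ha_odd : Odd a) (ha_sqf : Squarefree a) (hb : 0 < b) (hc : 0 < c)
    (hd : d = b ^ 2 + c ^ 2) (hd_sqf : Squarefree d) (had : IsCoprime a d)
    -- `r = √d`, `z = √(a(d + b√d))`, `w = √(a(d - b√d))`, and `L = ℚ(z)`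
    (r z w : L) (hr : r ^ 2 = d) (hz : z ^ 2 = a * (d + b * r))
    (hw : w ^ 2 = a * (d - b * r)) (hzw : z * w = a * c * r)
    (hL : IntermediateField.adjoin ℚ {z} = ⊤)
    -- a non-classical Hopf-Galois structure on `L/ℚ`
    {H : Type*} [Ring H] [HopfAlgebra ℚ H] [Module H L] [IsScalarTower ℚ H L]
    (hH : HopfGalois.IsHopfGalois ℚ L H) (hnc : ¬ HopfGalois.IsClassical ℚ L H) :
    -- the freeness criterion, in terms of the one of `b, c` that is normalized to be odd
    (Odd b →
      (Module.Free (HopfGalois.associatedOrder H L) (𝓞 L) ↔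
        ∃ x y : ℤ, x ^ 2 - d * y ^ 2 = b ∧ b ∣ x - c * y)) ∧
    (Even b →
      (Module.Free (HopfGalois.associatedOrder H L) (𝓞 L) ↔
        ∃ x y : ℤ, x ^ 2 - d * y ^ 2 = c ∧ c ∣ x - b * y)) ∧
    -- a free generator in each of the five cases
    (Even d → ∀ x y u : ℤ, x ^ 2 - d * y ^ 2 = b → x - c * y = b * u →
      HopfGalois.IsFreeGenerator H (1 + r + u * z + y * w)) ∧
    (Odd d → Odd b → ∀ x y u : ℤ, x ^ 2 - d * y ^ 2 = b → x - c * y = b * u →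
      HopfGalois.IsFreeGenerator H ((1 + r) / 2 + u * z + y * w)) ∧
    (Odd d → Even b → a + b ≡ 3 [ZMOD 4] →
      ∀ x y u : ℤ, x ^ 2 - d * y ^ 2 = c → x - b * y = c * u →
        HopfGalois.IsFreeGenerator H
          ((1 + r) / 2 + u * ((z + w) / 2) + y * ((z - w) / 2))) ∧
    (Odd d → Even b → a + b ≡ 1 [ZMOD 4] → a ≡ c [ZMOD 4] →
      ∀ x y u : ℤ, x ^ 2 - d * y ^ 2 = c → x - b * y = c * u →
        HopfGalois.IsFreeGenerator H
          (-((y + y % 2 : ℤ) : L) / 2 + ((y - u + 1 : ℤ) : L) / 2 * ((1 + r) / 2)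
            + u * ((1 + r + z + w) / 4) + y * ((1 - r + z - w) / 4))) ∧
    (Odd d → Even b → a + b ≡ 1 [ZMOD 4] → a ≡ -c [ZMOD 4] →
      ∀ x y u : ℤ, x ^ 2 - d * y ^ 2 = c → x - b * y = c * u →
        HopfGalois.IsFreeGenerator H
          (-((u - u % 2 : ℤ) : L) / 2 - ((y - u + 1 : ℤ) : L) / 2 * ((1 + r) / 2)
            + y * ((1 + r + z - w) / 4) + u * ((1 - r + z + w) / 4))) := by
  have Q : IsCyclicQuartic a b c d r z w :=
    ⟨ha_odd, ha_sqf, hb, hc, hd, hd_sqf, had, hr, hz, hw, hzw, hL⟩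
  have hd' : d = c ^ 2 + b ^ 2 := by rw [hd]; ring
  have gen1 : Even d → ∀ x y u : ℤ, x ^ 2 - d * y ^ 2 = b → x - c * y = b * u →
      IsFreeGenerator H (1 + r + u * z + y * w) := by
    intro hde x y u h1 h2
    have M := Q.isLatticeModel_of_even_d hH hnc hde
    have := M.isFreeGenerator (i := 1) (j := 0) (m := u) (n := y) (ε := 1)
      (Subsingleton.elim _ _) (Subsingleton.elim _ _) (by norm_num) (by norm_num)
      (form_eq_one hb hd h1 h2)
    refine (congrArg (IsFreeGenerator H) ?_).mp this
    simp only [vec]; push_cast; ring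
  have gen2 : Odd d → Odd b → ∀ x y u : ℤ, x ^ 2 - d * y ^ 2 = b → x - c * y = b * u →
      IsFreeGenerator H ((1 + r) / 2 + u * z + y * w) := by
    intro hdo hbo x y u h1 h2
    have M := Q.isLatticeModel_of_odd_b hH hnc hdo hbo
    have := M.isFreeGenerator (i := 1) (j := 0) (m := u) (n := y) (ε := 1)
      (Subsingleton.elim _ _) (Subsingleton.elim _ _) (by norm_num) (by norm_num)
      (form_eq_one hb hd h1 h2)
    refine (congrArg (IsFreeGenerator H) ?_).mp this
    simp only [vec]; push_cast; ring
  have gen3 : Odd d → Even b → a + b ≡ 3 [ZMOD 4] →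
      ∀ x y u : ℤ, x ^ 2 - d * y ^ 2 = c → x - b * y = c * u →
        IsFreeGenerator H ((1 + r) / 2 + u * ((z + w) / 2) + y * ((z - w) / 2)) := by
    intro _ hbe hab x y u h1 h2
    have M := Q.isLatticeModel_of_add_eq_three hH hnc hbe hab
    have := M.isFreeGenerator (i := 1) (j := 0) (m := u) (n := y) (ε := 1)
      (Subsingleton.elim _ _) (Subsingleton.elim _ _) (by norm_num) (by norm_num)
      (form_eq_one hc hd' h1 h2)
    refine (congrArg (IsFreeGenerator H) ?_).mp this
    simp only [vec]; push_cast; ring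
  -- `c` is odd and `b` even, so `u` and `y` have opposite parities
  have hpar : Even b → ∀ u y : ℤ, c * u ^ 2 + 2 * b * u * y - c * y ^ 2 = 1 →
      (y % 2 = 0 ∧ u % 2 = 1) ∨ (y % 2 = 1 ∧ u % 2 = 0) := by
    intro hbe u y h
    obtain ⟨t, ht⟩ := Q.odd_c_of_even_b hbe
    rw [ht] at h
    rcases Int.even_or_odd' u with ⟨s, rfl | rfl⟩ <;>
      rcases Int.even_or_odd' y with ⟨v, rfl | rfl⟩
    · ring_nf at h; omega
    · right; omega
    · left; omega
    · ring_nf at h; omega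
  have gen4 : Odd d → Even b → a + b ≡ 1 [ZMOD 4] → a ≡ c [ZMOD 4] →
      ∀ x y u : ℤ, x ^ 2 - d * y ^ 2 = c → x - b * y = c * u →
        IsFreeGenerator H
          (-((y + y % 2 : ℤ) : L) / 2 + ((y - u + 1 : ℤ) : L) / 2 * ((1 + r) / 2)
            + u * ((1 + r + z + w) / 4) + y * ((1 - r + z - w) / 4)) := by
    intro _ hbe hab hac x y u h1 h2
    have M := Q.isLatticeModel_of_add_eq_one hH hnc hbe hab (ε := 1) (Or.inl rfl)
      (by simpa using hac)
    have hF := form_eq_one hc hd' h1 h2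
    have hyu := hpar hbe u y hF
    -- `(i, j)` has to be `± (1, 0)` or `± (0, 1)`, and to be congruent to `(u, y)` modulo 2
    have := M.isFreeGenerator (i := 1 - y % 2) (j := -(y % 2)) (m := u) (n := y)
      (ε := 1 - 2 * (y % 2))
      ((ZMod.intCast_eq_intCast_iff_dvd_sub _ _ 2).2 (by push_cast; omega))
      ((ZMod.intCast_eq_intCast_iff_dvd_sub _ _ 2).2 (by push_cast; omega))
      (by rcases hyu with h | h <;> rw [h.1] <;> norm_num)
      (by rcases hyu with h | h <;> rw [h.1] <;> norm_num)
      hF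
    refine (congrArg (IsFreeGenerator H) ?_).mp this
    simp only [vec]; push_cast; ring
  have gen5 : Odd d → Even b → a + b ≡ 1 [ZMOD 4] → a ≡ -c [ZMOD 4] →
      ∀ x y u : ℤ, x ^ 2 - d * y ^ 2 = c → x - b * y = c * u →
        IsFreeGenerator H
          (-((u - u % 2 : ℤ) : L) / 2 - ((y - u + 1 : ℤ) : L) / 2 * ((1 + r) / 2)
            + y * ((1 + r + z - w) / 4) + u * ((1 - r + z + w) / 4)) := by
    intro _ hbe hab hac x y u h1 h2
    have M := Q.isLatticeModel_of_add_eq_one hH hnc hbe hab (ε := -1) (Or.inr rfl)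
      (by simpa using hac)
    have hF := form_eq_one hc hd' h1 h2
    have hyu := hpar hbe u y hF
    have := M.isFreeGenerator (i := u % 2) (j := u % 2 - 1) (m := u) (n := y)
      (ε := 2 * (u % 2) - 1)
      ((ZMod.intCast_eq_intCast_iff_dvd_sub _ _ 2).2 (by push_cast; omega))
      ((ZMod.intCast_eq_intCast_iff_dvd_sub _ _ 2).2 (by push_cast; omega))
      (by rcases hyu with h | h <;> rw [h.2] <;> norm_num)
      (by rcases hyu with h | h <;> rw [h.2] <;> norm_num)
      hF
    refine (congrArg (IsFreeGenerator H) ?_).mp this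
    simp only [vec]; push_cast; ring
  refine ⟨fun hbo => ⟨fun hfree => ?_, ?_⟩, fun hbe => ⟨fun hfree => ?_, ?_⟩, gen1, gen2, gen3,
    gen4, gen5⟩
  · obtain ⟨m, n, h⟩ : ∃ m n : ℤ, b * m ^ 2 + 2 * c * m * n - b * n ^ 2 = 1 := by
      rcases Int.even_or_odd d with hde | hdo
      · exact (Q.isLatticeModel_of_even_d hH hnc hde).exists_form_eq_one
      · exact (Q.isLatticeModel_of_odd_b hH hnc hdo hbo).exists_form_eq_one
    exact exists_of_form_eq_one hd h
  · rintro ⟨x, y, h1, u, h2⟩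
    rcases Int.even_or_odd d with hde | hdo
    · exact (gen1 hde x y u h1 h2).free
    · exact (gen2 hdo hbo x y u h1 h2).free
  all_goals
    have hdo := Q.odd_d_of_even_b hbe
    have hco := Q.odd_c_of_even_b hbe
    have hcases : a + b ≡ 3 [ZMOD 4] ∨ a + b ≡ 1 [ZMOD 4] ∧ (a ≡ c [ZMOD 4] ∨ a ≡ -c [ZMOD 4]) := by
      obtain ⟨s, hs⟩ := ha_odd
      obtain ⟨t, ht⟩ := hbe
      obtain ⟨v, hv⟩ := hco
      simp only [Int.ModEq]
      omega
  · obtain ⟨m, n, h⟩ : ∃ m n : ℤ, c * m ^ 2 + 2 * b * m * n - c * n ^ 2 = 1 := by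
      rcases hcases with hab | ⟨hab, hac | hac⟩
      · exact (Q.isLatticeModel_of_add_eq_three hH hnc hbe hab).exists_form_eq_one
      · exact (Q.isLatticeModel_of_add_eq_one hH hnc hbe hab (ε := 1) (Or.inl rfl)
          (by simpa using hac)).exists_form_eq_one
      · exact (Q.isLatticeModel_of_add_eq_one hH hnc hbe hab (ε := -1) (Or.inr rfl)
          (by simpa using hac)).exists_form_eq_one
    exact exists_of_form_eq_one hd' h
  · rintro ⟨x, y, h1, u, h2⟩
    rcases hcases with hab | ⟨hab, hac | hac⟩
    · exact (gen3 hdo hbe hab x y u h1 h2).free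
    · exact (gen4 hdo hbe hab hac x y u h1 h2).free
    · exact (gen5 hdo hbe hab hac x y u h1 h2).free
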